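/- Let $\widetilde G=\mathbb R^5$ with elements $(a^1,a^2,a^3,r,v)$ and group law $$(a^1,a^2,a^3,r,v)\cdot(b^1,b^2,b^3,s,w)=\bigl(a^1+b^1,\ a^2+b^2,\ a^3+b^3-a^2b^1,\ r+s,\ v+w+a^3b^1-\tfrac12a^2(b^1)^2+rb^2\bigr),$$ a three-step nilpotent Lie group whose Lie algebra $\tilde{\mathfrak g}$ has the basis $X_1,X_2,X_3,T,U$ with $[X_1,X_2]=X_3$, $[X_1,X_3]=-U=[X_2,T]$ (all other brackets of basis elements, up to antisymmetry, are $0$); here $(a^1,a^2,a^3,r,v)=\exp(a^1X_1)\exp(a^2X_2)\exp(a^3X_3)\exp(rT)\exp(vU)$. Let $\widetilde\Gamma=\{(a^1,a^2,a^3,r,v): a^1,a^2,a^3,r\in\mathbb Z,\ v\in\tfrac12\mathbb Z\}$ and $P=\widetilde\Gamma\backslash\widetilde G$ with its $\widetilde G$-invariant measure. $\widetilde G$ acts unitarily on $L^2(P)$ by $(\rho(g)f)(p)=f(p\cdot g)$, and for $k\in\mathbb Z$ the closed subspace $$L^2_k(P)=\{f\in L^2(P): f(p\cdot\exp(sU))=e^{-4\pi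 i ks}f(p)\ \text{ for all } s\in\mathbb R \text{ (for a.e. } p)\}$$ is invariant. Let $k\in\mathbb Z\setminus\{0\}$, and let $\pi_{-2k}$ be the unitary representation attached by the orbit method to the coadjoint orbit $\Omega_{-2k}$ through $(0,0,0,0,-2k)\in\tilde{\mathfrak g}^*$ (coordinates dual to $X_1,X_2,X_3,T,U$). That is, for $\lambda\in\Omega_{-2k}$ it is the representation $\operatorname{Ind}_{H}^{\widetilde G}\bar\lambda$ on $V_k=L^2(H\backslash\widetilde G)\simeq L^2(\mathbb R^2)$ induced from the character $\bar\lambda(h)=e^{2\pi i\langle\lambda,\log h\rangle}$ of $H=\exp(\mathbb RX_2\oplus\mathbb RX_3\oplus\mathbb RU)=\{(0,y,z,0,v)\}$, the subalgebra $\mathbb RX_2\oplus\mathbb RX_3\oplus\mathbb RU$ being subordinate to $\lambda$. Explicitly, $$(\pi_{-2k}(g)f)(x)=\bar\lambda(h(x,g))\,f(x\cdot g),\qquad s(x)\,g=h(x,g)\,s(x\cdot g),\quad h(x,g)\in H,$$ for the section $s:H\backslash\widetilde G\simeq\mathbb R^2\to\widetilde G$, $s(x,t)=(x,0,0,t,0)$.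 Then, for every choice of $\lambda\in\Omega_{-2k}$, $\pi_{-2k}$ is irreducible and occurs in $L^2_k(P)$ with multiplicity exactly $4k^2$: $$\dim_{\mathbb C}\operatorname{Hom}_{\widetilde G}(V_k,L^2_k(P))=4k^2,$$ where $\operatorname{Hom}_{\widetilde G}$ denotes bounded intertwining operators, and $L^2_k(P)$ is unitarily equivalent, as a representation of $\widetilde G$, to the orthogonal direct sum of $4k^2$ copies of $(\pi_{-2k},V_k)$. -/

import Mathlib

open MeasureTheory

noncomputable section

namespace KodairaThurston

/-! ### Unitary representations -/

/-- A homomorphism from `G` to the unitary group of the complex inner product space `V`. -/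
abbrev UnitaryRep (G V : Type*) [Group G] [NormedAddCommGroup V] [InnerProductSpace ℂ V] :=
  G →* (V ≃ₗᵢ[ℂ] V)

section Reps

variable {G V W : Type*} [Group G] [NormedAddCommGroup V] [InnerProductSpace ℂ V]
  [NormedAddCommGroup W] [InnerProductSpace ℂ W]

/-- Irreducibility: `V ≠ 0`, and the only closed invariant subspaces are `0` and `V`. -/
def IsIrreducible (π : UnitaryRep G V) : Prop :=
  Nontrivial V ∧ ∀ S : Submodule ℂ V, IsClosed (S : Set V) →
    (∀ g, ∀ v ∈ S, π g v ∈ S) → S = ⊥ ∨ S = ⊤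

/-- `Hom_G(V, W)`: the space of bounded operators that commute with the actions of `G`. -/
def intertwiners (π : UnitaryRep G V) (ρ : UnitaryRep G W) : Submodule ℂ (V →L[ℂ] W) where
  carrier := {A | ∀ g v, A (π g v) = ρ g (A v)}
  add_mem' := by
    intro A B hA hB g v
    simp [hA g v, hB g v]
  zero_mem' := by
    intro g v
    simp
  smul_mem' := by
    intro c A hA g v
    simp [hA g v]

/-- The multiplicity of the (irreducible) representation `π` in `ρ`. -/
def multiplicity (π : UnitaryRep G V) (ρ : UnitaryRep G W) : Cardinal :=
  Module.rank ℂ (intertwiners π ρ)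

/-- Unitary equivalence of representations. -/
def UnitarilyEquivalent (π : UnitaryRep G V) (ρ : UnitaryRep G W) : Prop :=
  ∃ A : V ≃ₗᵢ[ℂ] W, ∀ g v, A (π g v) = ρ g (A v)

/-- The orthogonal direct sum of `m` copies of `π`. -/
def copies (m : ℕ) (π : UnitaryRep G V) : UnitaryRep G (PiLp 2 (fun _ : Fin m => V)) where
  toFun g := LinearIsometryEquiv.piLpCongrRight 2 (fun _ => π g)
  map_one' := by
    ext v i
    simp
  map_mul' g h := by
    ext v i
    simp

end Reps

/-! ### Representations on `L²` given by a measure-preserving right action and a cocycle -/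

/-- A measure-preserving right action `act g x = x · g` of `G` on `(X, μ)`, with a measurable
`U(1)`-valued cocycle `coc g x`. -/
structure CocycleAction (G : Type*) {X : Type*} [Group G] [MeasurableSpace X]
    (μ : Measure X) where
  act : G → X → X
  coc : G → X → Circle
  act_one : ∀ x, act 1 x = x
  act_mul : ∀ g h x, act (g * h) x = act h (act g x)
  coc_one : ∀ x, coc 1 x = 1
  coc_mul : ∀ g h x, coc (g * h) x = coc g x * coc h (act g x)
  act_mp : ∀ g, MeasurePreserving (act g) μ μ
  coc_meas : ∀ g, Measurable fun x => (coc g x : ℂ)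

section Twist

variable {G X : Type*} [Group G] [MeasurableSpace X] {μ : Measure X}

theorem memLp_twist {c : X → Circle} (hc : Measurable fun x => (c x : ℂ)) {T : X → X}
    (hT : MeasurePreserving T μ μ) (f : Lp ℂ 2 μ) :
    MemLp (fun x => (c x : ℂ) * f (T x)) 2 μ := by
  have h : MemLp (fun x => f (T x)) 2 μ := (Lp.memLp f).comp_measurePreserving hT
  refine h.of_le_mul (c := 1) (hc.aestronglyMeasurable.mul h.1) ?_
  filter_upwards with x
  rw [norm_mul, Circle.norm_coe]

/-- The isometry `f ↦ (x ↦ c x * f (T x))` of `L²(X, μ)`. -/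
def twist (c : X → Circle) (hc : Measurable fun x => (c x : ℂ)) (T : X → X)
    (hT : MeasurePreserving T μ μ) : Lp ℂ 2 μ →ₗᵢ[ℂ] Lp ℂ 2 μ where
  toFun f := (memLp_twist hc hT f).toLp
  map_add' f f' := by
    apply Lp.ext
    filter_upwards [MemLp.coeFn_toLp (memLp_twist hc hT (f + f')),
      Lp.coeFn_add (memLp_twist hc hT f).toLp (memLp_twist hc hT f').toLp,
      MemLp.coeFn_toLp (memLp_twist hc hT f), MemLp.coeFn_toLp (memLp_twist hc hT f'),
      hT.quasiMeasurePreserving.ae (Lp.coeFn_add f f')] with x h1 h2 h3 h4 h5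
    rw [h1, h2, Pi.add_apply, h3, h4, h5, Pi.add_apply, mul_add]
  map_smul' a f := by
    apply Lp.ext
    filter_upwards [MemLp.coeFn_toLp (memLp_twist hc hT (a • f)),
      Lp.coeFn_smul a (memLp_twist hc hT f).toLp,
      MemLp.coeFn_toLp (memLp_twist hc hT f),
      hT.quasiMeasurePreserving.ae (Lp.coeFn_smul a f)] with x h1 h2 h3 h5
    simp only [RingHom.id_apply]
    rw [h1, h2, Pi.smul_apply, h3, h5, Pi.smul_apply, smul_eq_mul, smul_eq_mul]
    ring
  norm_map' f := by
    change ‖(memLp_twist hc hT f).toLp‖ = ‖f‖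
    rw [Lp.norm_toLp, Lp.norm_def]
    congr 1
    rw [← eLpNorm_comp_measurePreserving (Lp.memLp f).1 hT]
    apply eLpNorm_congr_norm_ae
    filter_upwards with x
    rw [norm_mul, Circle.norm_coe, one_mul]
    rfl

theorem coeFn_twist (c : X → Circle) (hc : Measurable fun x => (c x : ℂ)) (T : X → X)
    (hT : MeasurePreserving T μ μ) (f : Lp ℂ 2 μ) :
    ⇑(twist c hc T hT f) =ᵐ[μ] fun x => (c x : ℂ) * f (T x) :=
  MemLp.coeFn_toLp (memLp_twist hc hT f)

variable (A : CocycleAction G μ)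

theorem twist_one (f : Lp ℂ 2 μ) :
    twist (A.coc 1) (A.coc_meas 1) (A.act 1) (A.act_mp 1) f = f := by
  apply Lp.ext
  filter_upwards [coeFn_twist (A.coc 1) (A.coc_meas 1) (A.act 1) (A.act_mp 1) f] with x h
  rw [h, A.coc_one, A.act_one]
  simp

theorem twist_mul (g h : G) (f : Lp ℂ 2 μ) :
    twist (A.coc (g * h)) (A.coc_meas (g * h)) (A.act (g * h)) (A.act_mp (g * h)) f =
      twist (A.coc g) (A.coc_meas g) (A.act g) (A.act_mp g)
        (twist (A.coc h) (A.coc_meas h) (A.act h) (A.act_mp h) f) := by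
  apply Lp.ext
  filter_upwards [coeFn_twist (A.coc (g * h)) (A.coc_meas (g * h)) (A.act (g * h))
      (A.act_mp (g * h)) f,
    coeFn_twist (A.coc g) (A.coc_meas g) (A.act g) (A.act_mp g)
        (twist (A.coc h) (A.coc_meas h) (A.act h) (A.act_mp h) f),
    (A.act_mp g).quasiMeasurePreserving.ae
      (coeFn_twist (A.coc h) (A.coc_meas h) (A.act h) (A.act_mp h) f)] with x h1 h2 h3
  rw [h1, h2, h3, A.coc_mul, A.act_mul, Circle.coe_mul, mul_assoc]

/-- The unitary representation `(R(g) f)(x) = coc g x * f (x · g)` of `G` on `L²(X, μ)`. -/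
def CocycleAction.rep : UnitaryRep G (Lp ℂ 2 μ) where
  toFun g :=
    { (twist (A.coc g) (A.coc_meas g) (A.act g) (A.act_mp g)) with
      invFun := twist (A.coc g⁻¹) (A.coc_meas g⁻¹) (A.act g⁻¹) (A.act_mp g⁻¹)
      left_inv := by
        intro f
        refine (twist_mul A g⁻¹ g f).symm.trans ?_
        simp only [inv_mul_cancel]
        exact twist_one A f
      right_inv := by
        intro f
        refine (twist_mul A g g⁻¹ f).symm.trans ?_
        simp only [mul_inv_cancel]
        exact twist_one A f }
  map_one' := by
    ext1 f
    exact twist_one A f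
  map_mul' g h := by
    ext1 f
    exact twist_mul A g h f

theorem CocycleAction.coeFn_rep (g : G) (f : Lp ℂ 2 μ) :
    ⇑(A.rep g f) =ᵐ[μ] fun x => (A.coc g x : ℂ) * f (A.act g x) :=
  coeFn_twist (A.coc g) (A.coc_meas g) (A.act g) (A.act_mp g) f

end Twist

/-! ### The group `G̃` -/

/-- The three-step nilpotent Lie group `G̃`, in canonical coordinates:
`(a1, a2, a3, r, v) = exp(a1 X₁) exp(a2 X₂) exp(a3 X₃) exp(r T) exp(v U)`. -/
@[ext]
structure Gt where
  a1 : ℝ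
  a2 : ℝ
  a3 : ℝ
  r : ℝ
  v : ℝ

namespace Gt

/-- The group law, with the cocycle `ψ = a3 b1 - a2 b1² / 2 + r b2` in the last coordinate. -/
instance : Mul Gt :=
  ⟨fun g h => ⟨g.a1 + h.a1, g.a2 + h.a2, g.a3 + h.a3 - g.a2 * h.a1, g.r + h.r,
    g.v + h.v + g.a3 * h.a1 - g.a2 * h.a1 ^ 2 / 2 + g.r * h.a2⟩⟩

instance : One Gt := ⟨⟨0, 0, 0, 0, 0⟩⟩

instance : Inv Gt :=
  ⟨fun g => ⟨-g.a1, -g.a2, -g.a3 - g.a2 * g.a1, -g.r,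
    -g.v + g.a3 * g.a1 + g.a2 * g.a1 ^ 2 / 2 + g.r * g.a2⟩⟩

theorem mul_def (g h : Gt) : g * h =
    ⟨g.a1 + h.a1, g.a2 + h.a2, g.a3 + h.a3 - g.a2 * h.a1, g.r + h.r,
      g.v + h.v + g.a3 * h.a1 - g.a2 * h.a1 ^ 2 / 2 + g.r * h.a2⟩ := rfl

theorem one_def : (1 : Gt) = ⟨0, 0, 0, 0, 0⟩ := rfl

theorem inv_def (g : Gt) : g⁻¹ = ⟨-g.a1, -g.a2, -g.a3 - g.a2 * g.a1, -g.r,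
    -g.v + g.a3 * g.a1 + g.a2 * g.a1 ^ 2 / 2 + g.r * g.a2⟩ := rfl

instance : Group Gt :=
  Group.ofLeftAxioms
    (by intro a b c; ext <;> simp only [mul_def] <;> ring)
    (by intro a; ext <;> simp only [mul_def, one_def] <;> ring)
    (by intro a; ext <;> simp only [mul_def, one_def, inv_def] <;> ring)

/-- The coordinates of an element of `G̃`. -/
def coords : Gt ≃ ℝ × ℝ × ℝ × ℝ × ℝ where
  toFun g := (g.a1, g.a2, g.a3, g.r, g.v)
  invFun p := ⟨p.1, p.2.1, p.2.2.1, p.2.2.2.1, p.2.2.2.2⟩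
  left_inv _ := rfl
  right_inv _ := rfl

instance : MeasurableSpace Gt := MeasurableSpace.comap coords inferInstance

/-- The coordinates as an isomorphism of measurable spaces. -/
def measEquiv : Gt ≃ᵐ ℝ × ℝ × ℝ × ℝ × ℝ where
  toEquiv := coords
  measurable_toFun := comap_measurable coords
  measurable_invFun := by
    rintro _ ⟨t, ht, rfl⟩
    simpa [← Set.preimage_comp] using ht

/-- Haar measure of `G̃`: Lebesgue measure in the canonical coordinates. -/
instance : MeasureSpace Gt := ⟨Measure.map measEquiv.symm volume⟩

theorem measurePreserving_measEquiv : MeasurePreserving measEquiv (volume : Measure Gt) volume :=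
  (MeasurePreserving.symm measEquiv.symm ⟨measEquiv.symm.measurable, rfl⟩)

theorem measurable_mk {α : Type*} [MeasurableSpace α] {f1 f2 f3 f4 f5 : α → ℝ}
    (h1 : Measurable f1) (h2 : Measurable f2) (h3 : Measurable f3) (h4 : Measurable f4)
    (h5 : Measurable f5) : Measurable fun x => (⟨f1 x, f2 x, f3 x, f4 x, f5 x⟩ : Gt) :=
  measEquiv.symm.measurable.comp
    (h1.prodMk (h2.prodMk (h3.prodMk (h4.prodMk h5))))

theorem measurable_a1 : Measurable a1 := measEquiv.measurable.fst
theorem measurable_a2 : Measurable a2 := measEquiv.measurable.snd.fst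
theorem measurable_a3 : Measurable a3 := measEquiv.measurable.snd.snd.fst
theorem measurable_r : Measurable r := measEquiv.measurable.snd.snd.snd.fst
theorem measurable_v : Measurable v := measEquiv.measurable.snd.snd.snd.snd

/-- Triangular polynomial translations preserve Lebesgue measure. -/
theorem measurePreserving_triangular (c1 c2 c4 : ℝ) (p3 : ℝ → ℝ → ℝ) (p5 : ℝ → ℝ → ℝ → ℝ → ℝ)
    (h3 : Measurable fun q : ℝ × ℝ => p3 q.1 q.2)
    (h5 : Measurable fun q : ℝ × ℝ × ℝ × ℝ => p5 q.1 q.2.1 q.2.2.1 q.2.2.2) :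
    MeasurePreserving (fun g : Gt => (⟨g.a1 + c1, g.a2 + c2, g.a3 + p3 g.a1 g.a2, g.r + c4,
      g.v + p5 g.a1 g.a2 g.a3 g.r⟩ : Gt)) volume volume := by
  have key : MeasurePreserving (fun q : ℝ × ℝ × ℝ × ℝ × ℝ =>
      (q.1 + c1, q.2.1 + c2, q.2.2.1 + p3 q.1 q.2.1, q.2.2.2.1 + c4,
        q.2.2.2.2 + p5 q.1 q.2.1 q.2.2.1 q.2.2.2.1)) volume volume := by
    have e (c : ℝ) : MeasurePreserving (fun x : ℝ => x + c) volume volume :=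
      measurePreserving_add_right volume c
    have m3 (q1 q2 : ℝ) : MeasurePreserving (fun q : ℝ × ℝ × ℝ =>
        (q.1 + p3 q1 q2, q.2.1 + c4, q.2.2 + p5 q1 q2 q.1 q.2.1)) volume volume := by
      refine (e (p3 q1 q2)).skew_product
        (g := fun q3 (q : ℝ × ℝ) => (q.1 + c4, q.2 + p5 q1 q2 q3 q.1)) ?_ ?_
      · have : Measurable fun q : ℝ × ℝ × ℝ => p5 q1 q2 q.1 q.2.1 :=
          h5.comp (by fun_prop : Measurable fun q : ℝ × ℝ × ℝ => (q1, q2, q.1, q.2.1))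
        unfold Function.uncurry
        fun_prop
      · filter_upwards with q3
        refine ((e c4).skew_product (g := fun q4 (q : ℝ) => q + p5 q1 q2 q3 q4) ?_ ?_).map_eq
        · have : Measurable fun q : ℝ × ℝ => p5 q1 q2 q3 q.1 :=
            h5.comp (by fun_prop : Measurable fun q : ℝ × ℝ => (q1, q2, q3, q.1))
          unfold Function.uncurry
          fun_prop
        · filter_upwards with q4
          exact (e _).map_eq
    refine (e c1).skew_product (g := fun q1 (q : ℝ × ℝ × ℝ × ℝ) =>
      (q.1 + c2, q.2.1 + p3 q1 q.1, q.2.2.1 + c4, q.2.2.2 + p5 q1 q.1 q.2.1 q.2.2.1)) ?_ ?_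
    · have t3 : Measurable fun q : ℝ × ℝ × ℝ × ℝ × ℝ => p3 q.1 q.2.1 :=
        h3.comp (by fun_prop : Measurable fun q : ℝ × ℝ × ℝ × ℝ × ℝ => (q.1, q.2.1))
      have t5 : Measurable fun q : ℝ × ℝ × ℝ × ℝ × ℝ => p5 q.1 q.2.1 q.2.2.1 q.2.2.2.1 :=
        h5.comp (by fun_prop :
          Measurable fun q : ℝ × ℝ × ℝ × ℝ × ℝ => (q.1, q.2.1, q.2.2.1, q.2.2.2.1))
      unfold Function.uncurry
      fun_prop
    · filter_upwards with q1
      refine ((e c2).skew_product (g := fun q2 (q : ℝ × ℝ × ℝ) =>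
        (q.1 + p3 q1 q2, q.2.1 + c4, q.2.2 + p5 q1 q2 q.1 q.2.1)) ?_ ?_).map_eq
      · have t3 : Measurable fun q : ℝ × ℝ × ℝ × ℝ => p3 q1 q.1 :=
          h3.comp (by fun_prop : Measurable fun q : ℝ × ℝ × ℝ × ℝ => (q1, q.1))
        have t5 : Measurable fun q : ℝ × ℝ × ℝ × ℝ => p5 q1 q.1 q.2.1 q.2.2.1 :=
          h5.comp (by fun_prop :
            Measurable fun q : ℝ × ℝ × ℝ × ℝ => (q1, q.1, q.2.1, q.2.2.1))
        unfold Function.uncurry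
        fun_prop
      · filter_upwards with q2
        exact (m3 q1 q2).map_eq
  exact ((MeasurePreserving.symm _ measurePreserving_measEquiv).comp key).comp
    measurePreserving_measEquiv

theorem measurePreserving_mul_right (h : Gt) :
    MeasurePreserving (fun g : Gt => g * h) volume volume := by
  convert measurePreserving_triangular h.a1 h.a2 h.r (fun _ y => h.a3 - y * h.a1)
    (fun _ y z t => h.v + z * h.a1 - y * h.a1 ^ 2 / 2 + t * h.a2)
    (by fun_prop) (by fun_prop) using 1
  funext g
  rw [mul_def]
  ext <;> simp only <;> ring

theorem measurePreserving_mul_left (h : Gt) :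
    MeasurePreserving (fun g : Gt => h * g) volume volume := by
  convert measurePreserving_triangular h.a1 h.a2 h.r (fun x _ => h.a3 - h.a2 * x)
    (fun x y _ _ => h.v + h.a3 * x - h.a2 * x ^ 2 / 2 + h.r * y)
    (by fun_prop) (by fun_prop) using 1
  funext g
  rw [mul_def]
  ext <;> simp only <;> ring

end Gt

/-! ### The lattice and the circle bundle `P = Γ̃ \ G̃` -/

/-- The lattice `Γ̃`: integral `a1, a2, a3, r`, and `v ∈ ½ℤ`. -/
def Gam : Subgroup Gt where
  carrier := {g | (∃ n : ℤ, g.a1 = n) ∧ (∃ n : ℤ, g.a2 = n) ∧ (∃ n : ℤ, g.a3 = n) ∧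
    (∃ n : ℤ, g.r = n) ∧ ∃ n : ℤ, g.v = n / 2}
  mul_mem' := by
    rintro g h ⟨⟨x, hx⟩, ⟨y, hy⟩, ⟨z, hz⟩, ⟨t, ht⟩, ⟨v, hv⟩⟩
      ⟨⟨x', hx'⟩, ⟨y', hy'⟩, ⟨z', hz'⟩, ⟨t', ht'⟩, ⟨v', hv'⟩⟩
    refine ⟨⟨x + x', ?_⟩, ⟨y + y', ?_⟩, ⟨z + z' - y * x', ?_⟩, ⟨t + t', ?_⟩,
      ⟨v + v' + 2 * z * x' - y * x' ^ 2 + 2 * t * y', ?_⟩⟩ <;>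
    · simp only [Gt.mul_def, hx, hy, hz, ht, hv, hx', hy', hz', ht', hv']
      push_cast
      ring
  one_mem' := ⟨⟨0, by simp [Gt.one_def]⟩, ⟨0, by simp [Gt.one_def]⟩, ⟨0, by simp [Gt.one_def]⟩,
    ⟨0, by simp [Gt.one_def]⟩, ⟨0, by simp [Gt.one_def]⟩⟩
  inv_mem' := by
    rintro g ⟨⟨x, hx⟩, ⟨y, hy⟩, ⟨z, hz⟩, ⟨t, ht⟩, ⟨v, hv⟩⟩
    refine ⟨⟨-x, ?_⟩, ⟨-y, ?_⟩, ⟨-z - y * x, ?_⟩, ⟨-t, ?_⟩,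
      ⟨-v + 2 * z * x + y * x ^ 2 + 2 * t * y, ?_⟩⟩ <;>
    · simp only [Gt.inv_def, hx, hy, hz, ht, hv]
      push_cast
      ring

theorem countable_Gam : Countable Gam := by
  refine Function.Surjective.countable (α := {q : ℤ × ℤ × ℤ × ℤ × ℤ //
    (⟨q.1, q.2.1, q.2.2.1, q.2.2.2.1, q.2.2.2.2 / 2⟩ : Gt) ∈ Gam})
    (f := fun q => ⟨_, q.2⟩) ?_
  rintro ⟨g, hg⟩
  obtain ⟨⟨x, hx⟩, ⟨y, hy⟩, ⟨z, hz⟩, ⟨t, ht⟩, ⟨v, hv⟩⟩ := id hg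
  have e : (⟨x, y, z, t, v / 2⟩ : Gt) = g := by
    ext <;> simp [hx, hy, hz, ht, hv]
  refine ⟨⟨(x, y, z, t, v), ?_⟩, ?_⟩
  · rw [e]
    exact hg
  · exact Subtype.ext e

/-- The quotient `P = Γ̃ \ G̃` (the set of cosets `Γ̃ g`). -/
abbrev P : Type := Quotient (QuotientGroup.rightRel Gam)

/-- The projection `g ↦ Γ̃ g`. -/
def toP (g : Gt) : P := Quotient.mk (QuotientGroup.rightRel Gam) g

theorem toP_eq_iff {g h : Gt} : toP g = toP h ↔ ∃ c : Gam, (c : Gt) * g = h := by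
  unfold toP
  rw [Quotient.eq, QuotientGroup.rightRel_apply]
  constructor
  · intro hh
    exact ⟨⟨h * g⁻¹, hh⟩, by simp⟩
  · rintro ⟨c, rfl⟩
    simp

theorem measurable_toP : Measurable toP := fun _ hs => hs

/-- The right action `Γ̃ g · h = Γ̃ g h` of `G̃` on `P`. -/
def actP (h : Gt) : P → P :=
  Quotient.lift (fun g => toP (g * h)) (by
    intro g g' hg
    obtain ⟨c, rfl⟩ := toP_eq_iff.1 (Quotient.sound hg : toP g = toP g')
    exact toP_eq_iff.2 ⟨c, by rw [mul_assoc]⟩)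

theorem actP_toP (h g : Gt) : actP h (toP g) = toP (g * h) := rfl

/-- The fundamental domain `[0,1)⁴ × [0,½)` of `Γ̃`. -/
def domainP : Set Gt :=
  {g | g.a1 ∈ Set.Ico (0 : ℝ) 1 ∧ g.a2 ∈ Set.Ico (0 : ℝ) 1 ∧ g.a3 ∈ Set.Ico (0 : ℝ) 1 ∧
    g.r ∈ Set.Ico (0 : ℝ) 1 ∧ g.v ∈ Set.Ico (0 : ℝ) (1 / 2)}

/-- The `G̃`-invariant measure on `P`: the image of Haar measure on a fundamental domain. -/
def volP : Measure P := Measure.map toP ((volume : Measure Gt).restrict domainP)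

theorem measurableSet_domainP : MeasurableSet domainP :=
  (Gt.measurable_a1 measurableSet_Ico).inter ((Gt.measurable_a2 measurableSet_Ico).inter
    ((Gt.measurable_a3 measurableSet_Ico).inter ((Gt.measurable_r measurableSet_Ico).inter
      (Gt.measurable_v measurableSet_Ico))))

theorem existsUnique_int (x : ℝ) : ∃! n : ℤ, (n : ℝ) + x ∈ Set.Ico (0 : ℝ) 1 := by
  simpa [add_comm] using existsUnique_add_zsmul_mem_Ico (zero_lt_one' ℝ) x 0

theorem existsUnique_half (x : ℝ) : ∃! n : ℤ, (n : ℝ) / 2 + x ∈ Set.Ico (0 : ℝ) (1 / 2) := by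
  have := existsUnique_add_zsmul_mem_Ico (by norm_num : (0 : ℝ) < 1 / 2) x 0
  simpa [add_comm, div_eq_mul_inv] using this

theorem isFundamentalDomain_domainP : IsFundamentalDomain Gam domainP := by
  refine IsFundamentalDomain.mk' measurableSet_domainP.nullMeasurableSet ?_
  intro g
  obtain ⟨x, hx, ux⟩ := existsUnique_int g.a1
  obtain ⟨y, hy, uy⟩ := existsUnique_int g.a2
  obtain ⟨z, hz, uz⟩ := existsUnique_int (g.a3 - y * g.a1)
  obtain ⟨t, ht, ut⟩ := existsUnique_int g.r
  obtain ⟨v, hv, uv⟩ := existsUnique_half (g.v + z * g.a1 - y * g.a1 ^ 2 / 2 + t * g.a2)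
  refine ⟨⟨⟨x, y, z, t, v / 2⟩, ⟨x, rfl⟩, ⟨y, rfl⟩, ⟨z, rfl⟩, ⟨t, rfl⟩, ⟨v, rfl⟩⟩, ?_, ?_⟩
  · change (⟨x, y, z, t, v / 2⟩ : Gt) * g ∈ domainP
    rw [Gt.mul_def]
    refine ⟨hx, hy, ?_, ht, ?_⟩
    · convert hz using 1
      simp only
      ring
    · convert hv using 1
      simp only
      ring
  · rintro ⟨c, ⟨x', hx'⟩, ⟨y', hy'⟩, ⟨z', hz'⟩, ⟨t', ht'⟩, ⟨v', hv'⟩⟩ hc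
    change c * g ∈ domainP at hc
    rw [Gt.mul_def] at hc
    obtain ⟨h1, h2, h3, h4, h5⟩ := hc
    simp only [hx', hy', hz', ht', hv'] at h1 h2 h3 h4 h5
    obtain rfl := ux x' h1
    obtain rfl := uy y' h2
    obtain rfl := ut t' h4
    obtain rfl := uz z' (by convert h3 using 1; ring)
    obtain rfl := uv v' (by convert h5 using 1; ring)
    apply Subtype.ext
    ext <;> assumption

instance : SMulInvariantMeasure Gam Gt volume :=
  ⟨fun c _ hs => (Gt.measurePreserving_mul_left c).measure_preimage hs.nullMeasurableSet⟩

instance : MeasurableConstSMul Gam Gt :=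
  ⟨fun c => (Gt.measurePreserving_mul_left c).measurable⟩

theorem measurePreserving_actP (h : Gt) : MeasurePreserving (actP h) volP volP := by
  have : Countable Gam := countable_Gam
  have hm : Measurable (actP h) := by
    apply measurable_from_quotient.2
    exact measurable_toP.comp (Gt.measurePreserving_mul_right h).measurable
  refine ⟨hm, ?_⟩
  ext s hs
  have hR := Gt.measurePreserving_mul_right h
  have hR' := Gt.measurePreserving_mul_right h⁻¹
  have hB : MeasurableSet (toP ⁻¹' s) := measurable_toP hs
  have hfd : IsFundamentalDomain Gam ((fun g : Gt => g * h⁻¹) ⁻¹' domainP) := by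
    refine isFundamentalDomain_domainP.preimage_of_equiv (f := fun g : Gt => g * h⁻¹) (e := id)
      hR'.quasiMeasurePreserving Function.bijective_id ?_
    intro c g
    exact mul_assoc (c : Gt) g h⁻¹
  rw [Measure.map_apply hm hs, volP, Measure.map_apply measurable_toP (hm hs),
    Measure.map_apply measurable_toP hs, Measure.restrict_apply (measurable_toP (hm hs)),
    Measure.restrict_apply hB]
  have e1 : toP ⁻¹' (actP h ⁻¹' s) ∩ domainP =
      (fun g : Gt => g * h) ⁻¹' (toP ⁻¹' s ∩ (fun g : Gt => g * h⁻¹) ⁻¹' domainP) := by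
    ext g
    simp [actP_toP]
  rw [e1, hR.measure_preimage
    (hB.inter (hR'.measurable measurableSet_domainP)).nullMeasurableSet]
  refine hfd.measure_set_eq isFundamentalDomain_domainP hB ?_
  intro c
  ext g
  have : toP (c • g) = toP g := (toP_eq_iff.2 ⟨c, rfl⟩).symm
  simp [this]

/-- The right quasi-regular representation `(ρ(g) f)(p) = f(p · g)` of `G̃` on `L²(P)`. -/
def rho : UnitaryRep Gt (Lp ℂ 2 volP) :=
  CocycleAction.rep
    { act := actP
      coc := fun _ _ => 1
      act_one := by
        intro x
        induction x using Quotient.inductionOn with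
        | h g => exact congrArg toP (mul_one g)
      act_mul := by
        intro g h x
        induction x using Quotient.inductionOn with
        | h c => exact congrArg toP (mul_assoc c g h).symm
      coc_one := fun _ => rfl
      coc_mul := fun _ _ _ => (mul_one 1).symm
      act_mp := measurePreserving_actP
      coc_meas := fun _ => measurable_const }

theorem rho_mul (g h : Gt) (f : Lp ℂ 2 volP) : rho (g * h) f = rho g (rho h f) := by
  rw [map_mul]
  rfl

/-- The central element `exp(s U)`. -/
def center (s : ℝ) : Gt := ⟨0, 0, 0, 0, s⟩

theorem center_mul_comm (s : ℝ) (g : Gt) : center s * g = g * center s := by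
  simp only [Gt.mul_def, center]
  ext <;> simp
  ring

/-- `L²_k(P)`: the `f ∈ L²(P)` with `f(p · exp(s U)) = e^{-4π i k s} f(p)` for all `s`; the
structure circle of `P` is `exp(ℝ U)` modulo `exp(½ℤ U)`. -/
def L2k (k : ℤ) : Submodule ℂ (Lp ℂ 2 volP) where
  carrier := {f | ∀ s : ℝ, rho (center s) f = (Circle.exp (-(4 * Real.pi * k * s)) : ℂ) • f}
  add_mem' := by
    intro f f' hf hf' s
    rw [map_add, hf s, hf' s, smul_add]
  zero_mem' := by
    intro s
    simp
  smul_mem' := by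
    intro c f hf s
    rw [map_smul, hf s, smul_comm]

theorem rho_mem_L2k {k : ℤ} (g : Gt) {f : Lp ℂ 2 volP} (hf : f ∈ L2k k) : rho g f ∈ L2k k := by
  intro s
  have h1 : rho (center s) (rho g f) = rho g (rho (center s) f) := by
    rw [← rho_mul, ← rho_mul, center_mul_comm]
  rw [h1, hf s, map_smul]

/-- The representation of `G̃` on `L²_k(P)` by right translation. -/
def rhoK (k : ℤ) : UnitaryRep Gt (L2k k) where
  toFun g :=
    { toFun := fun f => ⟨rho g f, rho_mem_L2k g f.2⟩
      invFun := fun f => ⟨rho g⁻¹ f, rho_mem_L2k g⁻¹ f.2⟩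
      map_add' := by
        intro f f'
        ext1
        simp
      map_smul' := by
        intro c f
        ext1
        simp
      left_inv := by
        intro f
        ext1
        simp only
        rw [← rho_mul]
        simp
      right_inv := by
        intro f
        ext1
        simp only
        rw [← rho_mul]
        simp
      norm_map' := fun f => (rho g).norm_map f }
  map_one' := by
    ext1 f
    apply Subtype.ext
    change rho 1 (f : Lp ℂ 2 volP) = f
    simp
  map_mul' g h := by
    ext1 f
    apply Subtype.ext
    change rho (g * h) (f : Lp ℂ 2 volP) = rho g (rho h f)
    rw [rho_mul]

/-! ### Coadjoint orbits and subordinate subalgebras -/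

/-- The Lie algebra of `G̃`, identified with `ℝ⁵` by its basis `X₁, X₂, X₃, T, U`. -/
abbrev LieGt : Type := ℝ × ℝ × ℝ × ℝ × ℝ

/-- The bracket with `[X₁, X₂] = X₃` and `[X₁, X₃] = -U = [X₂, T]`. -/
def bracket (X Y : LieGt) : LieGt :=
  (0, 0, X.1 * Y.2.1 - X.2.1 * Y.1, 0,
    -(X.1 * Y.2.2.1 - X.2.2.1 * Y.1) - (X.2.1 * Y.2.2.2.1 - X.2.2.2.1 * Y.2.1))

/-- The adjoint action `Ad(g)`: the derivative at the identity of `x ↦ g x g⁻¹`. -/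
def Ad (g : Gt) : LieGt →L[ℝ] LieGt :=
  fderiv ℝ (fun X : LieGt => Gt.coords (g * Gt.coords.symm X * g⁻¹)) 0

/-- The coadjoint orbit of `l`, i.e. the set of all `Ad*(g) l = l ∘ Ad(g⁻¹)`. -/
def coadjointOrbit (l : Module.Dual ℝ LieGt) : Set (Module.Dual ℝ LieGt) :=
  {l' | ∃ g : Gt, ∀ X, l' X = l (Ad g⁻¹ X)}

/-- The functional `(0, 0, 0, 0, μ)` in the basis dual to `X₁, X₂, X₃, T, U`. -/
def uFunctional (μ : ℝ) : Module.Dual ℝ LieGt where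
  toFun X := μ * X.2.2.2.2
  map_add' X Y := by simp [mul_add]
  map_smul' c X := by simp [mul_left_comm]

/-- `h` is a subalgebra on which `l([·,·])` vanishes. -/
def IsIsotropicSubalgebra (l : Module.Dual ℝ LieGt) (h : Submodule ℝ LieGt) : Prop :=
  ∀ X ∈ h, ∀ Y ∈ h, bracket X Y ∈ h ∧ l (bracket X Y) = 0

/-- `h` is subordinate to `l`: of maximal dimension among the subalgebras with
`l|_{[h,h]} = 0`. -/
def IsSubordinate (l : Module.Dual ℝ LieGt) (h : Submodule ℝ LieGt) : Prop :=
  IsIsotropicSubalgebra l h ∧ ∀ h' : Submodule ℝ LieGt, IsIsotropicSubalgebra l h' →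
    Module.finrank ℝ h' ≤ Module.finrank ℝ h

/-- The subalgebra `h⁰ = ℝ X₂ ⊕ ℝ X₃ ⊕ ℝ U`. -/
def h0 : Submodule ℝ LieGt where
  carrier := {X | X.1 = 0 ∧ X.2.2.2.1 = 0}
  add_mem' := by
    rintro X Y ⟨h1, h2⟩ ⟨h3, h4⟩
    simp [h1, h2, h3, h4]
  zero_mem' := by simp
  smul_mem' := by
    rintro c X ⟨h1, h2⟩
    simp [h1, h2]

/-! ### The representation attached to a coadjoint orbit -/

/-- The analytic subgroup `H⁰ = {(0, y, z, 0, v)}` with Lie algebra `h⁰`. -/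
def H0 : Subgroup Gt where
  carrier := {g | g.a1 = 0 ∧ g.r = 0}
  mul_mem' := by
    rintro g h ⟨h1, h2⟩ ⟨h3, h4⟩
    simp [Gt.mul_def, h1, h2, h3, h4]
  one_mem' := by simp [Gt.one_def]
  inv_mem' := by
    rintro g ⟨h1, h2⟩
    simp [Gt.inv_def, h1, h2]

/-- The logarithm `H⁰ → h⁰`. Since `h⁰` is commutative,
`exp(y X₂ + z X₃ + v U) = exp(y X₂) exp(z X₃) exp(v U)`, so it is the identity in coordinates. -/
def logH0 (h : H0) : LieGt := Gt.coords h

/-- The character `h ↦ exp(2π i ⟨l, log h⟩)` of `H⁰`. -/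
def character (l : Module.Dual ℝ LieGt) : H0 →* Circle where
  toFun h := Circle.exp (2 * Real.pi * l (logH0 h))
  map_one' := by
    have : logH0 1 = 0 := rfl
    simp [this]
  map_mul' g h := by
    have : logH0 (g * h) = logH0 g + logH0 h := by
      obtain ⟨g, hg1, hg2⟩ := g
      obtain ⟨h, hh1, hh2⟩ := h
      simp [logH0, Gt.coords, Gt.mul_def, hg1, hg2, hh1, hh2]
    rw [this, map_add, mul_add, Circle.exp_add]

/-- The section `(x, t) ↦ (x, 0, 0, t, 0)` of `G̃ → H⁰ \ G̃ ≃ ℝ²`. -/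
def sec (p : ℝ × ℝ) : Gt := ⟨p.1, 0, 0, p.2, 0⟩

/-- The right action of `G̃` on `H⁰ \ G̃ ≃ ℝ²`. -/
def actH (g : Gt) (p : ℝ × ℝ) : ℝ × ℝ := (p.1 + g.a1, p.2 + g.r)

/-- The solution `h(p, g) = s(p) g s(p · g)⁻¹ ∈ H⁰` of the master equation
`s(p) g = h(p, g) s(p · g)`. -/
def master (g : Gt) (p : ℝ × ℝ) : H0 :=
  ⟨sec p * g * (sec (actH g p))⁻¹, by
    constructor <;> simp [Gt.mul_def, Gt.inv_def, sec, actH]⟩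

theorem sec_mul (g : Gt) (p : ℝ × ℝ) : sec p * g = (master g p : Gt) * sec (actH g p) := by
  simp [master]

theorem actH_mul (g h : Gt) (p : ℝ × ℝ) : actH (g * h) p = actH h (actH g p) := by
  simp [actH, Gt.mul_def, add_assoc]

theorem measurePreserving_actH (g : Gt) :
    MeasurePreserving (actH g) (volume : Measure (ℝ × ℝ)) volume :=
  (measurePreserving_add_right volume g.a1).prod (measurePreserving_add_right volume g.r)

/-- The induced representation `Ind_{H⁰}^{G̃}` of the character attached to `l`, on
`L²(H⁰ \ G̃) = L²(ℝ²)`: `(π(g) f)(p) = exp(2π i ⟨l, log h(p, g)⟩) f(p · g)`. -/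
def inducedRep (l : Module.Dual ℝ LieGt) :
    UnitaryRep Gt (Lp ℂ 2 (volume : Measure (ℝ × ℝ))) :=
  CocycleAction.rep
    { act := actH
      coc := fun g p => character l (master g p)
      act_one := by
        intro p
        simp [actH, Gt.one_def]
      act_mul := actH_mul
      coc_one := by
        intro p
        have : master 1 p = 1 := by
          apply Subtype.ext
          simp [master, actH, Gt.one_def, sec, Gt.mul_def, Gt.inv_def]
        rw [this, map_one]
      coc_mul := by
        intro g h p
        rw [← map_mul]
        congr 1
        apply Subtype.ext
        simp [master, actH_mul, mul_assoc]
      act_mp := measurePreserving_actH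
      coc_meas := by
        intro g
        have h1 : Continuous fun p => logH0 (master g p) := by
          unfold logH0 master Gt.coords
          simp only [Gt.mul_def, Gt.inv_def, sec, actH, Equiv.coe_fn_mk]
          fun_prop
        have h2 : Continuous l := LinearMap.continuous_of_finiteDimensional l
        have h3 : Continuous fun p => Circle.exp (2 * Real.pi * l (logH0 (master g p))) := by
          fun_prop
        exact (continuous_subtype_val.comp h3).measurable }

/-- `h⁰` is subordinate to each functional that is nonzero on `U`. -/
theorem isSubordinate_h0 (l : Module.Dual ℝ LieGt) (hl : l (0, 0, 0, 0, 1) ≠ 0) :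
    IsSubordinate l h0 := by
  obtain ⟨p, q, hq, hdec⟩ : ∃ p q : ℝ, q ≠ 0 ∧ ∀ a b : ℝ, l (0, 0, a, 0, b) = a * p + b * q := by
    refine ⟨l (0, 0, 1, 0, 0), l (0, 0, 0, 0, 1), hl, fun a b => ?_⟩
    rw [← smul_eq_mul, ← smul_eq_mul, ← map_smul, ← map_smul, ← map_add]
    simp
  refine ⟨?_, ?_⟩
  · rintro X ⟨h1, h2⟩ Y ⟨h3, h4⟩
    have : bracket X Y = 0 := by simp [bracket, h1, h2, h3, h4]
    rw [this, map_zero]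
    exact ⟨zero_mem _, rfl⟩
  · intro h' hh'
    have h3 : Module.finrank ℝ h0 = 3 := by
      let e : h0 ≃ₗ[ℝ] ℝ × ℝ × ℝ :=
        { toFun := fun X => (X.1.2.1, X.1.2.2.1, X.1.2.2.2.2)
          invFun := fun q => ⟨(0, q.1, q.2.1, 0, q.2.2), rfl, rfl⟩
          map_add' := fun _ _ => rfl
          map_smul' := fun _ _ => rfl
          left_inv := by
            rintro ⟨⟨x, y, z, t, v⟩, h1, h2⟩
            simp only at h1 h2
            subst h1 h2
            rfl
          right_inv := fun _ => rfl }
      rw [e.finrank_eq]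
      simp
    let B : LinearMap.BilinForm ℝ LieGt := LinearMap.mk₂ ℝ (fun X Y => l (bracket X Y))
      (by intro X X' Y; simp only [bracket, hdec]; simp; ring)
      (by intro c X Y; simp only [bracket, hdec]; simp; ring)
      (by intro X Y Y'; simp only [bracket, hdec]; simp; ring)
      (by intro c X Y; simp only [bracket, hdec]; simp; ring)
    have hB (X Y : LieGt) : B X Y = l (bracket X Y) := rfl
    have hrefl : B.IsRefl := by
      intro X Y hXY
      rw [hB, bracket, hdec] at hXY ⊢
      linarith
    have key := LinearMap.BilinForm.finrank_add_finrank_orthogonal hrefl h'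
    have hle : h' ≤ B.orthogonal h' := by
      intro X hX Y hY
      exact (hh' Y hY X hX).2
    have hrad : h' ⊓ B.orthogonal ⊤ ≤ Submodule.span ℝ {((0, 0, 0, 0, 1) : LieGt)} := by
      rintro ⟨x, y, z, t, v⟩ ⟨-, hX⟩
      have hY (Y : LieGt) : l (bracket Y (x, y, z, t, v)) = 0 := hX Y trivial
      have e1 := hY (0, 0, 1, 0, 0)
      have e2 := hY (0, 0, 0, 1, 0)
      have e3 := hY (1, 0, 0, 0, 0)
      have e4 := hY (0, 1, 0, 0, 0)
      simp only [bracket, hdec] at e1 e2 e3 e4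
      simp [hq] at e1 e2 e3 e4
      subst e1 e2
      simp [hq] at e3 e4
      subst e3 e4
      exact Submodule.mem_span_singleton.2 ⟨v, by simp⟩
    have f1 := Submodule.finrank_mono hle
    have f2 := (Submodule.finrank_mono hrad).trans (finrank_span_le_card _)
    rw [Set.toFinset_singleton, Finset.card_singleton] at f2
    have f3 : Module.finrank ℝ LieGt = 5 := by simp
    omega

end KodairaThurston

end

open MeasureTheory

noncomputable section

namespace KodairaThurston

/-! ### Representations with scalar commutant -/

section Commutant

variable {G V W : Type*} [Group G] [NormedAddCommGroup V] [InnerProductSpace ℂ V]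
  [NormedAddCommGroup W] [InnerProductSpace ℂ W]

/-! The group `H0` is abelian and normal, and its integral points form a lattice with quotient a
three-torus. Writing points of `P` as cosets of `h * s(p)` gives a map `theta` from plane times
torus to `P`, and `f` in `L²(P)` has a Fourier series along the torus with coefficients `coef f ν
p`. Three facts about these coefficients decide everything.

Right translation by `g` multiplies the `ν`-th coefficient by the character `ν` of `h(p, g)` and
moves `p` to `p · g` (`coef_rho`). This is the formula of the representation induced from the
functional with frequency `ν`. Membership in `L2k k` leaves only the frequencies with `ν 2 = -k`
(`coef_eq_zero`), that is, functionals with value `-2k` on `U`. Since left multiplication by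
integral elements is invisible in `P`, translating `p` by an integral vector `a` permutes the
frequencies: `coef f ν (p + a) = coef f (shiftFreq a ν) p` (`coef_shift`).

The group `ℤ²` acts freely on the frequencies with `ν 2 = -k`, with `(2|k|)²` orbits represented by
`freq k j`. Hence Parseval over one unit cell, summed over all frequencies, unfolds into a sum over
`j` of integrals over the whole plane (`tsum_lintegral_coef`): up to the factor 2 between the
measures, `f` goes isometrically to the `4k²` functions `coef f (freq k j)` in `L²(ℝ²)`. All the
induced representations involved are equivalent, because a translation of the plane changes the
functional freely on `X₂` and `X₃` (`unitarilyEquivalent_inducedRep`).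

Surjectivity needs no inverse construction. The commutant of the induced representation is scalar
(`hasScalarCommutant_inducedRep`), so the projection onto the image is a matrix of scalars, and it
is the identity once the components are linearly independent (`unitarilyEquivalent_copies`).
Independence is tested on functions with a single frequency class (`exists_single_freq`).
Irreducibility and the multiplicity also follow from the scalar commutant. -/

/-- Every bounded operator commuting with `π` is a scalar. -/
def HasScalarCommutant (π : UnitaryRep G V) : Prop :=
  ∀ A ∈ intertwiners π π, ∃ c : ℂ, ∀ v, A v = c • v

theorem UnitarilyEquivalent.symm {π : UnitaryRep G V} {ρ : UnitaryRep G W}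
    (h : UnitarilyEquivalent π ρ) : UnitarilyEquivalent ρ π := by
  obtain ⟨A, hA⟩ := h
  refine ⟨A.symm, fun g v => ?_⟩
  rw [LinearIsometryEquiv.symm_apply_eq, hA, LinearIsometryEquiv.apply_symm_apply]

theorem rep_inv_apply (π : UnitaryRep G V) (g : G) (v : V) : π g (π g⁻¹ v) = v := by
  change (π g * π g⁻¹) v = v
  rw [← map_mul, mul_inv_cancel, map_one]
  rfl

theorem inner_rep_left (π : UnitaryRep G V) (g : G) (v w : V) :
    inner ℂ (π g v) w = inner ℂ v (π g⁻¹ w) := by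
  conv_lhs => rw [← rep_inv_apply π g w]
  exact (π g).inner_map_map _ _

/-- The orthogonal projection onto a closed invariant subspace is an intertwining operator. -/
theorem starProjection_mem_intertwiners (π : UnitaryRep G V) (S : Submodule ℂ V)
    [S.HasOrthogonalProjection] (hS : ∀ g, ∀ v ∈ S, π g v ∈ S) :
    S.starProjection ∈ intertwiners π π := by
  intro g v
  refine Submodule.eq_starProjection_of_mem_of_inner_eq_zero
    (hS g _ (S.starProjection_apply_mem v)) fun w hw => ?_
  rw [← map_sub, inner_rep_left]
  exact S.starProjection_inner_eq_zero v _ (hS _ _ hw)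

/-- The projection onto a closed invariant subspace is an intertwiner, hence a scalar `c`: the
subspace is zero if `c = 0`, and everything otherwise. -/
theorem HasScalarCommutant.isIrreducible [CompleteSpace V] [Nontrivial V] {π : UnitaryRep G V}
    (h : HasScalarCommutant π) : IsIrreducible π := by
  refine ⟨inferInstance, fun S hS hinv => ?_⟩
  have : CompleteSpace S := hS.completeSpace_coe
  obtain ⟨c, hc⟩ := h _ (starProjection_mem_intertwiners π S hinv)
  by_cases h0 : c = 0
  · left
    rw [Submodule.eq_bot_iff]
    intro v hv
    rw [← Submodule.starProjection_eq_self_iff.2 hv, hc, h0, zero_smul]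
  · right
    rw [Submodule.eq_top_iff']
    intro v
    have := S.smul_mem c⁻¹ (S.starProjection_apply_mem v)
    rwa [hc, smul_smul, inv_mul_cancel₀ h0, one_smul] at this

theorem copies_apply {m : ℕ} (π : UnitaryRep G V) (g : G) (v : PiLp 2 (fun _ : Fin m => V))
    (i : Fin m) : copies m π g v i = π g (v i) := rfl

/-- The matrix entries of an operator that commutes with the copies of `π` are scalars. -/
theorem HasScalarCommutant.exists_matrix {m : ℕ} {π : UnitaryRep G V} (h : HasScalarCommutant π)
    {A : PiLp 2 (fun _ : Fin m => V) →L[ℂ] PiLp 2 (fun _ : Fin m => V)}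
    (hA : A ∈ intertwiners (copies m π) (copies m π)) :
    ∃ a : Fin m → Fin m → ℂ, ∀ v i, A v i = ∑ j, a i j • v j := by
  have key (i j : Fin m) : ∃ c : ℂ, ∀ v : V, A (PiLp.single 2 j v) i = c • v := by
    let E : V →L[ℂ] PiLp 2 (fun _ : Fin m => V) :=
      (PiLp.continuousLinearEquiv 2 ℂ (fun _ : Fin m => V)).symm.toContinuousLinearMap ∘L
        ContinuousLinearMap.single ℂ (fun _ : Fin m => V) j
    have hE (v : V) : E v = PiLp.single 2 j v := rfl
    refine h (PiLp.proj 2 (fun _ : Fin m => V) i ∘L A ∘L E) fun g v => ?_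
    have h1 : E (π g v) = copies m π g (E v) := by
      ext l
      rw [copies_apply, hE, hE]
      by_cases hl : l = j
      · subst hl
        simp
      · simp [hl]
    change A (E (π g v)) i = π g (A (E v) i)
    rw [h1, hA, copies_apply]
  choose a ha using key
  refine ⟨a, fun v i => ?_⟩
  have hv : v = ∑ j, PiLp.single 2 j (v j) := by
    ext l
    simp [Finset.sum_apply, Pi.single_apply]
  conv_lhs => rw [hv, map_sum]
  simp [ha]

/-- An isometric intertwining operator into `m` copies of `π`, whose components are linearly
independent, is surjective. -/
theorem HasScalarCommutant.unitarilyEquivalent_copies [CompleteSpace V] [CompleteSpace W] {m : ℕ}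
    {π : UnitaryRep G V} (h : HasScalarCommutant π) {ρ : UnitaryRep G W}
    (B : W →ₗᵢ[ℂ] PiLp 2 (fun _ : Fin m => V))
    (hB : ∀ g w i, B (ρ g w) i = π g (B w i))
    (hind : ∀ c : Fin m → ℂ, (∀ w, ∑ j, c j • B w j = 0) → c = 0) :
    UnitarilyEquivalent (copies m π) ρ := by
  have hB' (g : G) (w : W) : B (ρ g w) = copies m π g (B w) := by
    ext i
    exact hB g w i
  let S : Submodule ℂ (PiLp 2 (fun _ : Fin m => V)) := LinearMap.range B.toLinearMap
  have hSc : CompleteSpace S := by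
    have : IsComplete (Set.range B) := by
      rw [← Set.image_univ]
      exact (isComplete_image_iff B.isometry.isUniformInducing).2
        isComplete_univ
    exact IsComplete.completeSpace_coe this
  have hinv : ∀ g, ∀ v ∈ S, copies m π g v ∈ S := by
    rintro g _ ⟨w, rfl⟩
    exact ⟨ρ g w, hB' g w⟩
  obtain ⟨a, ha⟩ := h.exists_matrix (starProjection_mem_intertwiners _ S hinv)
  -- The projection fixes every `B w`, so each row of its matrix minus the identity is a linear
  -- relation among the components of `B`.
  have hid (i : Fin m) : (fun j => a i j - if i = j then 1 else 0) = 0 := by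
    refine hind _ fun w => ?_
    have h1 : S.starProjection (B w) = B w := Submodule.starProjection_eq_self_iff.2 ⟨w, rfl⟩
    have h2 := ha (B w) i
    rw [h1] at h2
    simp only [sub_smul, Finset.sum_sub_distrib, ← h2, ite_smul, one_smul, zero_smul,
      Finset.sum_ite_eq, Finset.mem_univ, if_true, sub_self]
  have hsurj : Function.Surjective B := by
    intro v
    have : S.starProjection v = v := by
      ext i
      rw [ha]
      have e (j : Fin m) : a i j = if i = j then 1 else 0 := sub_eq_zero.1 (congrFun (hid i) j)
      simp [e]
    obtain ⟨w, hw⟩ := Submodule.starProjection_eq_self_iff.1 this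
    exact ⟨w, hw⟩
  exact UnitarilyEquivalent.symm ⟨LinearIsometryEquiv.ofSurjective B hsurj, hB'⟩

/-- The multiplicity of `π` in `m` copies of itself is `m`. -/
theorem HasScalarCommutant.multiplicity_eq [Nontrivial V] {m : ℕ} {π : UnitaryRep G V}
    (h : HasScalarCommutant π) {ρ : UnitaryRep G W}
    (e : UnitarilyEquivalent (copies m π) ρ) : multiplicity π ρ = m := by
  obtain ⟨E, hE⟩ := e
  let D (c : Fin m → ℂ) : V →L[ℂ] PiLp 2 (fun _ : Fin m => V) :=
    (PiLp.continuousLinearEquiv 2 ℂ (fun _ : Fin m => V)).symm.toContinuousLinearMap ∘L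
      ContinuousLinearMap.pi fun i => c i • ContinuousLinearMap.id ℂ V
  have hD (c : Fin m → ℂ) (v : V) (i : Fin m) : D c v i = c i • v := rfl
  -- Intertwiners correspond to vectors of scalars `c` through `v ↦ E (c i • v)`; the components of
  -- any intertwiner are scalars by hypothesis.
  let F : (Fin m → ℂ) →ₗ[ℂ] intertwiners π ρ :=
    { toFun := fun c => ⟨E.toLinearIsometry.toContinuousLinearMap ∘L D c, fun g v => by
        change E (D c (π g v)) = ρ g (E (D c v))
        rw [← hE]
        congr 1
        ext i
        rw [copies_apply, hD, hD, map_smul]⟩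
      map_add' := fun c d => by
        ext v
        change E (D (c + d) v) = E (D c v) + E (D d v)
        rw [← map_add]
        congr 1
        ext i
        simp [hD, add_smul]
      map_smul' := fun c d => by
        ext v
        change E (D (c • d) v) = c • E (D d v)
        rw [← map_smul]
        congr 1
        ext i
        simp [hD, mul_smul] }
  have hF (c : Fin m → ℂ) (v : V) : (F c : V →L[ℂ] W) v = E (D c v) := rfl
  have hbij : Function.Bijective F := by
    constructor
    · intro c d hcd
      obtain ⟨v, hv⟩ := exists_ne (0 : V)
      ext i
      have h1 : D c v = D d v := E.injective (by rw [← hF, hcd, hF])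
      have h2 := congrArg (fun w : PiLp 2 (fun _ : Fin m => V) => w i) h1
      exact smul_left_injective ℂ hv h2
    · intro A
      have key (i : Fin m) : ∃ c : ℂ, ∀ v : V, E.symm ((A : V →L[ℂ] W) v) i = c • v := by
        refine h (PiLp.proj 2 (fun _ : Fin m => V) i ∘L
          E.symm.toLinearIsometry.toContinuousLinearMap ∘L (A : V →L[ℂ] W)) fun g v => ?_
        change E.symm ((A : V →L[ℂ] W) (π g v)) i = π g (E.symm ((A : V →L[ℂ] W) v) i)
        have h1 : E.symm (ρ g ((A : V →L[ℂ] W) v)) = copies m π g (E.symm ((A : V →L[ℂ] W) v)) := by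
          rw [LinearIsometryEquiv.symm_apply_eq, hE, LinearIsometryEquiv.apply_symm_apply]
        rw [A.2 g v, h1, copies_apply]
      choose c hc using key
      refine ⟨c, ?_⟩
      ext v
      rw [hF, ← LinearIsometryEquiv.eq_symm_apply]
      ext i
      rw [hD, hc]
  -- The two spaces may live in different universes, so their ranks are compared after lifting.
  have h1 := (LinearEquiv.ofBijective F hbij).lift_rank_eq
  rw [rank_fin_fun, Cardinal.lift_natCast] at h1
  rw [multiplicity, ← Cardinal.lift_injective.eq_iff, ← h1, Cardinal.lift_natCast]

end Commutant

/-! ### Uniqueness of Fourier transforms of integrable functions -/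

section FourierUniqueness

open Complex ComplexConjugate

variable {X E : Type*} [MeasurableSpace X] {μ : Measure X} [NormedAddCommGroup E] [NormedSpace ℝ E]
  [MeasurableSpace E] [BorelSpace E] [SecondCountableTopology E] [CompleteSpace E]

/-- `ENNReal.ofReal` truncates at zero, so the densities built from `u` and `-u` are its positive
and negative parts. The hypothesis makes the characteristic functions of the two finite image
measures on `E` agree, so the two parts agree almost everywhere; as one of them vanishes at each
point, both do. -/
theorem ae_eq_zero_of_integral_char_real (S : X ≃ᵐ E) {u : X → ℝ} (hu : Integrable u μ)
    (h : ∀ L : StrongDual ℝ E, ∫ x, cexp (L (S x) * I) * (u x : ℂ) ∂μ = 0) : u =ᵐ[μ] 0 := by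
  have hfin {w : X → ℝ} (hw : Integrable w μ) :
      IsFiniteMeasure (μ.withDensity fun x => ENNReal.ofReal (w x)) :=
    isFiniteMeasure_withDensity_ofReal hw.2
  have hp := hfin hu
  have hn := hfin hu.neg
  have hexp (L : StrongDual ℝ E) : Measurable fun x => cexp (L (S x) * I) := by
    have : Measurable fun x => L (S x) := L.continuous.measurable.comp S.measurable
    fun_prop
  have hint (L : StrongDual ℝ E) {w : X → ℝ} (hw : Integrable w μ) :
      Integrable (fun x => cexp (L (S x) * I) * ((max (w x) 0 : ℝ) : ℂ)) μ := by
    refine (hw.pos_part.ofReal (𝕜 := ℂ)).bdd_mul (c := 1) (hexp L).aestronglyMeasurable ?_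
    filter_upwards with x
    rw [norm_exp_ofReal_mul_I]
  have hchar (L : StrongDual ℝ E) {w : X → ℝ} (hw : Integrable w μ) :
      charFunDual (Measure.map S (μ.withDensity fun x => ENNReal.ofReal (w x))) L =
        ∫ x, cexp (L (S x) * I) * ((max (w x) 0 : ℝ) : ℂ) ∂μ := by
    rw [charFunDual_apply, S.measurableEmbedding.integral_map,
      integral_withDensity_eq_integral_toReal_smul₀ hw.aemeasurable.ennreal_ofReal
        (by filter_upwards with x using ENNReal.ofReal_lt_top)]
    refine integral_congr_ae ?_
    filter_upwards with x
    rw [ENNReal.toReal_ofReal', real_smul, mul_comm]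
  have key : Measure.map S (μ.withDensity fun x => ENNReal.ofReal (u x)) =
      Measure.map S (μ.withDensity fun x => ENNReal.ofReal ((-u) x)) := by
    have := Measure.isFiniteMeasure_map (μ.withDensity fun x => ENNReal.ofReal (u x)) S
    have := Measure.isFiniteMeasure_map (μ.withDensity fun x => ENNReal.ofReal ((-u) x)) S
    refine Measure.ext_of_charFunDual ?_
    ext L
    rw [hchar L hu, hchar L hu.neg, ← sub_eq_zero, ← integral_sub (hint L hu) (hint L hu.neg),
      ← h L]
    refine integral_congr_ae ?_
    filter_upwards with x
    rw [← mul_sub, ← ofReal_sub, Pi.neg_apply]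
    congr 2
    rcases le_total (u x) 0 with hx | hx
    · rw [max_eq_right hx, max_eq_left (by linarith)]
      ring
    · rw [max_eq_left hx, max_eq_right (by linarith)]
      ring
  have h1 := (withDensity_eq_iff hu.aemeasurable.ennreal_ofReal
    hu.neg.aemeasurable.ennreal_ofReal hu.lintegral_lt_top.ne).1
    (MeasurableEquiv.map_measurableEquiv_injective S key)
  filter_upwards [h1] with x hx
  rw [Pi.neg_apply] at hx
  rcases le_total (u x) 0 with h0 | h0
  · rw [ENNReal.ofReal_of_nonpos h0, eq_comm, ENNReal.ofReal_eq_zero] at hx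
    exact le_antisymm h0 (neg_nonpos.1 hx)
  · rw [ENNReal.ofReal_of_nonpos (by linarith : -u x ≤ 0), ENNReal.ofReal_eq_zero] at hx
    exact le_antisymm hx h0

/-- Conjugation turns the hypothesis for `-L` into the hypothesis for the conjugate of `u`, so the
real case applies to the real and imaginary parts. -/
theorem ae_eq_zero_of_integral_char (S : X ≃ᵐ E) {u : X → ℂ} (hu : Integrable u μ)
    (h : ∀ L : StrongDual ℝ E, ∫ x, cexp (L (S x) * I) * u x ∂μ = 0) : u =ᵐ[μ] 0 := by
  have hexp (L : StrongDual ℝ E) : Measurable fun x => cexp (L (S x) * I) := by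
    have : Measurable fun x => L (S x) := L.continuous.measurable.comp S.measurable
    fun_prop
  have hint (L : StrongDual ℝ E) {w : X → ℂ} (hw : Integrable w μ) :
      Integrable (fun x => cexp (L (S x) * I) * w x) μ := by
    refine hw.bdd_mul (c := 1) (hexp L).aestronglyMeasurable ?_
    filter_upwards with x
    rw [norm_exp_ofReal_mul_I]
  have hconj (L : StrongDual ℝ E) : ∫ x, cexp (L (S x) * I) * conj (u x) ∂μ = 0 := by
    have h1 := congrArg conj (h (-L))
    rw [← integral_conj, map_zero] at h1
    rw [← h1]
    refine integral_congr_ae ?_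
    filter_upwards with x
    simp [← exp_conj]
  have hcu : Integrable (fun x => conj (u x)) μ := by
    simpa using (conjCLE : ℂ →L[ℝ] ℂ).integrable_comp hu
  have hre : (fun x => (u x).re) =ᵐ[μ] 0 := by
    refine ae_eq_zero_of_integral_char_real S hu.re fun L => ?_
    have : ∫ x, (2 : ℂ)⁻¹ * (cexp (L (S x) * I) * u x + cexp (L (S x) * I) * conj (u x)) ∂μ = 0 := by
      rw [integral_const_mul, integral_add (hint L hu) (hint L hcu), h, hconj]
      simp
    rw [← this]
    refine integral_congr_ae ?_
    filter_upwards with x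
    rw [re_eq_add_conj]
    ring
  have him : (fun x => (u x).im) =ᵐ[μ] 0 := by
    refine ae_eq_zero_of_integral_char_real S hu.im fun L => ?_
    have : ∫ x, (2 * I : ℂ)⁻¹ *
        (cexp (L (S x) * I) * u x - cexp (L (S x) * I) * conj (u x)) ∂μ = 0 := by
      rw [integral_const_mul, integral_sub (hint L hu) (hint L hcu), h, hconj]
      simp
    rw [← this]
    refine integral_congr_ae ?_
    filter_upwards with x
    rw [im_eq_sub_conj]
    ring
  filter_upwards [hre, him] with x h1 h2
  exact Complex.ext h1 h2

end FourierUniqueness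

/-! ### Functions invariant under translations -/

/-- Fubini exchanges the quantifiers: for some base point `p`, almost every translate of `p` has the
value `m p`. -/
theorem ae_eq_const_of_translation_invariant {m : ℝ × ℝ → ℂ} (hm : Measurable m)
    (h : ∀ a : ℝ × ℝ, ∀ᵐ p, m (p + a) = m p) : ∃ c, ∀ᵐ p, m p = c := by
  have hs : MeasurableSet {q : (ℝ × ℝ) × (ℝ × ℝ) | m (q.2 + q.1) = m q.2} :=
    measurableSet_eq_fun (by fun_prop) (by fun_prop)
  have h1 : ∀ᵐ p : ℝ × ℝ, ∀ᵐ a : ℝ × ℝ, m (p + a) = m p :=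
    (Measure.ae_ae_comm hs).1 (Filter.Eventually.of_forall h)
  obtain ⟨p, hp⟩ := h1.exists
  refine ⟨m p, ?_⟩
  have := (measurePreserving_add_left (volume : Measure (ℝ × ℝ)) (-p)).quasiMeasurePreserving.ae hp
  filter_upwards [this] with a ha
  simpa using ha

/-! ### The commutant of the induced representations -/

theorem logH0_master (g : Gt) (p : ℝ × ℝ) : logH0 (master g p) =
    (0, g.a2, g.a3 + g.a2 * (p.1 + g.a1), 0,
      g.v + p.2 * g.a2 - g.a3 * (p.1 + g.a1) - g.a2 * (p.1 + g.a1) ^ 2 / 2) := by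
  simp only [logH0, master, Gt.coords, Gt.mul_def, Gt.inv_def, sec, actH, Equiv.coe_fn_mk,
    Prod.mk.injEq]
  refine ⟨?_, ?_, ?_, ?_, ?_⟩ <;> ring

theorem dual_apply (l : Module.Dual ℝ LieGt) (y z v : ℝ) : l (0, y, z, 0, v) =
    y * l (0, 1, 0, 0, 0) + z * l (0, 0, 1, 0, 0) + v * l (0, 0, 0, 0, 1) := by
  rw [← smul_eq_mul, ← smul_eq_mul, ← smul_eq_mul, ← map_smul, ← map_smul, ← map_smul, ← map_add,
    ← map_add]
  simp

theorem coe_character_master (l : Module.Dual ℝ LieGt) (g : Gt) (p : ℝ × ℝ) :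
    (character l (master g p) : ℂ) = Complex.exp (((2 * Real.pi * (g.a2 * l (0, 1, 0, 0, 0) +
      (g.a3 + g.a2 * (p.1 + g.a1)) * l (0, 0, 1, 0, 0) +
      (g.v + p.2 * g.a2 - g.a3 * (p.1 + g.a1) - g.a2 * (p.1 + g.a1) ^ 2 / 2) *
        l (0, 0, 0, 0, 1)) : ℝ) : ℂ) * Complex.I) := by
  change ((Circle.exp (2 * Real.pi * l (logH0 (master g p))) : Circle) : ℂ) = _
  rw [logH0_master, dual_apply, Circle.coe_exp]

theorem coeFn_inducedRep (l : Module.Dual ℝ LieGt) (g : Gt)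
    (f : Lp ℂ 2 (volume : Measure (ℝ × ℝ))) : ⇑(inducedRep l g f) =ᵐ[volume]
      fun p => (character l (master g p) : ℂ) * f (actH g p) :=
  CocycleAction.coeFn_rep _ g f

/-- The coordinates on `H⁰ \ G̃` in which `exp(ℝ X₂ ⊕ ℝ X₃)` acts by characters of `ℝ²`. -/
def shear (b c μ : ℝ) (hμ : μ ≠ 0) : ℝ × ℝ ≃ᵐ ℝ × ℝ where
  -- These are the coefficients of `g.a2` and `g.a3` in the phase of `coe_character_master` when
  -- `g.a1 = 0`. The second recovers `p.1` and the first then recovers `p.2`, since `μ ≠ 0`.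
  toFun p := (b + c * p.1 + μ * (p.2 - p.1 ^ 2 / 2), c - μ * p.1)
  invFun q := ((c - q.2) / μ, (q.1 - b - c * ((c - q.2) / μ)) / μ + ((c - q.2) / μ) ^ 2 / 2)
  left_inv p := by
    ext <;> simp only <;> field_simp <;> ring
  right_inv q := by
    ext <;> simp only <;> field_simp <;> ring
  measurable_toFun := by
    simp only [Equiv.coe_fn_mk]
    fun_prop
  measurable_invFun := by
    simp only [Equiv.coe_fn_symm_mk]
    fun_prop

/-- The square root of a positive integrable function, available by σ-finiteness. It replaces the
constant 1, which is not square-integrable on the plane, as a vector to divide by. -/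
theorem exists_pos_L2 : ∃ f : Lp ℂ 2 (volume : Measure (ℝ × ℝ)), ∀ᵐ p, f p ≠ 0 := by
  obtain ⟨g, hg, hgm, hgi⟩ := exists_pos_lintegral_lt_of_sigmaFinite
    (volume : Measure (ℝ × ℝ)) one_ne_zero
  have hL : MemLp (fun p => ((Real.sqrt (g p) : ℝ) : ℂ)) 2 (volume : Measure (ℝ × ℝ)) := by
    have hm : Measurable fun p => ((Real.sqrt (g p) : ℝ) : ℂ) := by fun_prop
    rw [memLp_two_iff_integrable_sq_norm hm.aestronglyMeasurable]
    have : (fun p => ‖((Real.sqrt (g p) : ℝ) : ℂ)‖ ^ 2) = fun p => (g p : ℝ) := by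
      funext p
      rw [Complex.norm_real, Real.norm_of_nonneg (Real.sqrt_nonneg _),
        Real.sq_sqrt (g p).coe_nonneg]
    rw [this]
    refine ⟨by fun_prop, ?_⟩
    rw [hasFiniteIntegral_iff_enorm]
    simpa using hgi.trans ENNReal.one_lt_top
  refine ⟨hL.toLp, ?_⟩
  filter_upwards [hL.coeFn_toLp] with p hp
  rw [hp]
  have : 0 < Real.sqrt (g p) := Real.sqrt_pos.2 (hg p)
  exact_mod_cast this.ne'

/-- The elements `(0, y, z, 0, 0)` act by multiplication by all characters in the `shear`
coordinates, and these separate integrable functions; so an operator commuting with them is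
multiplication by a function `m`. Commuting with the translations `(x, 0, 0, t, 0)` makes `m`
constant. -/
theorem hasScalarCommutant_inducedRep (l : Module.Dual ℝ LieGt) (hl : l (0, 0, 0, 0, 1) ≠ 0) :
    HasScalarCommutant (inducedRep l) := by
  intro T hT
  obtain ⟨f0, hf0⟩ := exists_pos_L2
  set h0 := ContinuousLinearMap.adjoint T f0 with hh0
  have hmul (f : Lp ℂ 2 (volume : Measure (ℝ × ℝ))) :
      (fun p => inner ℂ (f0 p) (T f p) - inner ℂ (h0 p) (f p)) =ᵐ[volume] 0 := by
    refine ae_eq_zero_of_integral_char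
      (shear (l (0, 1, 0, 0, 0)) (l (0, 0, 1, 0, 0)) (l (0, 0, 0, 0, 1)) hl)
      ((L2.integrable_inner f0 (T f)).sub (L2.integrable_inner h0 f)) fun L => ?_
    -- The factor `2π` of the character cancels, so `g` acts by multiplication by `exp(i L(shear
    -- p))`.
    let g : Gt := ⟨0, L (1, 0) / (2 * Real.pi), L (0, 1) / (2 * Real.pi), 0, 0⟩
    have hLS (p : ℝ × ℝ) : Complex.exp (L (shear (l (0, 1, 0, 0, 0)) (l (0, 0, 1, 0, 0))
        (l (0, 0, 0, 0, 1)) hl p) * Complex.I) = character l (master g p) := by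
      rw [coe_character_master]
      congr 3
      have hL (y z : ℝ) : L (y, z) = y * L (1, 0) + z * L (0, 1) := by
        rw [← smul_eq_mul, ← smul_eq_mul, ← map_smul, ← map_smul, ← map_add]
        simp
      change L (_, _) = _
      rw [hL]
      simp only [g]
      field_simp
      ring
    have hact (p : ℝ × ℝ) : actH g p = p := by simp [actH, g]
    have e1 : inner ℂ f0 (T (inducedRep l g f)) = inner ℂ f0 (inducedRep l g (T f)) := by
      rw [hT g f]
    rw [← ContinuousLinearMap.adjoint_inner_left, ← hh0, ← sub_eq_zero, L2.inner_def, L2.inner_def,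
      ← integral_sub (L2.integrable_inner _ _) (L2.integrable_inner _ _), ← neg_eq_zero,
      ← integral_neg] at e1
    rw [← e1]
    refine integral_congr_ae ?_
    filter_upwards [coeFn_inducedRep l g f, coeFn_inducedRep l g (T f)] with p h1 h2
    rw [h1, h2, hact, hLS]
    simp only [RCLike.inner_apply]
    ring
  -- The pointwise identity `conj (f0) * T f = conj (h0) * f`, with `h0` the adjoint applied to
  -- `f0`, is solved for `T f`.
  let m : ℝ × ℝ → ℂ := fun p => starRingEnd ℂ (h0 p / f0 p)
  have hm : Measurable m := by
    have h1 := (Lp.stronglyMeasurable h0).measurable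
    have h2 := (Lp.stronglyMeasurable f0).measurable
    exact Complex.continuous_conj.measurable.comp (h1.div h2)
  have hTm (f : Lp ℂ 2 (volume : Measure (ℝ × ℝ))) : ∀ᵐ p, T f p = m p * f p := by
    filter_upwards [hmul f, hf0] with p h1 h2
    simp only [RCLike.inner_apply, Pi.zero_apply] at h1
    have h3 : starRingEnd ℂ (f0 p) ≠ 0 := by simpa using h2
    simp only [m, map_div₀]
    field_simp
    linear_combination h1
  have hinv (a : ℝ × ℝ) : ∀ᵐ p, m (p + a) = m p := by
    let g : Gt := ⟨a.1, 0, 0, a.2, 0⟩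
    have hact (p : ℝ × ℝ) : actH g p = p + a := rfl
    have hchar (p : ℝ × ℝ) : (character l (master g p) : ℂ) = 1 := by
      rw [coe_character_master]
      simp [g]
    have hq := (measurePreserving_actH g).quasiMeasurePreserving
    have h4 := hT g f0
    filter_upwards [hTm (inducedRep l g f0), coeFn_inducedRep l g f0,
      coeFn_inducedRep l g (T f0), hq.ae (hTm f0), hq.ae hf0] with p h1 h2 h3 h5 h6
    rw [h4, h3, h2, hchar, h5, one_mul, one_mul, hact] at h1
    rw [hact] at h6
    exact mul_right_cancel₀ h6 h1
  obtain ⟨c, hc⟩ := ae_eq_const_of_translation_invariant hm hinv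
  refine ⟨c, fun f => Lp.ext ?_⟩
  filter_upwards [hTm f, hc, Lp.coeFn_smul c f] with p h1 h2 h3
  rw [h1, h2, h3, Pi.smul_apply, smul_eq_mul]

theorem nontrivial_L2 : Nontrivial (Lp ℂ 2 (volume : Measure (ℝ × ℝ))) := by
  obtain ⟨f, hf⟩ := exists_pos_L2
  refine ⟨f, 0, fun h => ?_⟩
  obtain ⟨p, h1, h2⟩ := (hf.and (Lp.coeFn_zero ℂ 2 (volume : Measure (ℝ × ℝ)))).exists
  rw [h] at h1
  exact h1 h2

/-! ### Independence of the functional -/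

/-- A translation of the plane by `(q1, q2)` is the intertwiner: it replaces `c` by `c - μ q1` and
`b` by `b + c q1 + μ (q2 - q1²/2)`, and leaves `μ` alone. -/
theorem unitarilyEquivalent_inducedRep (l l' : Module.Dual ℝ LieGt)
    (hl : l (0, 0, 0, 0, 1) ≠ 0) (h : l (0, 0, 0, 0, 1) = l' (0, 0, 0, 0, 1)) :
    UnitarilyEquivalent (inducedRep l) (inducedRep l') := by
  obtain ⟨μ, hμ⟩ : ∃ μ, l (0, 0, 0, 0, 1) = μ := ⟨_, rfl⟩
  obtain ⟨b, hb⟩ : ∃ b, l (0, 1, 0, 0, 0) = b := ⟨_, rfl⟩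
  obtain ⟨c, hc⟩ : ∃ c, l (0, 0, 1, 0, 0) = c := ⟨_, rfl⟩
  obtain ⟨b', hb'⟩ : ∃ b, l' (0, 1, 0, 0, 0) = b := ⟨_, rfl⟩
  obtain ⟨c', hc'⟩ : ∃ c, l' (0, 0, 1, 0, 0) = c := ⟨_, rfl⟩
  rw [hμ] at hl h
  obtain ⟨q1, hq1⟩ : ∃ q, q = (c - c') / μ := ⟨_, rfl⟩
  obtain ⟨q2, hq2⟩ : ∃ q, q = (b' - b - c * q1 + μ * q1 ^ 2 / 2) / μ := ⟨_, rfl⟩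
  rw [eq_div_iff hl] at hq1 hq2
  let s : Gt := ⟨q1, 0, 0, q2, 0⟩
  -- The zero functional has trivial character, so `inducedRep 0 s` is the plain translation,
  -- already packaged as a unitary operator.
  have hs (f : Lp ℂ 2 (volume : Measure (ℝ × ℝ))) :
      ⇑(inducedRep 0 s f) =ᵐ[volume] fun p => f (actH s p) := by
    filter_upwards [coeFn_inducedRep 0 s f] with p hp
    rw [hp, coe_character_master]
    simp
  refine ⟨inducedRep 0 s, fun g f => Lp.ext ?_⟩
  have hq := fun g => (measurePreserving_actH g).quasiMeasurePreserving
  filter_upwards [hs (inducedRep l g f), coeFn_inducedRep l' g (inducedRep 0 s f),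
    (hq s).ae (coeFn_inducedRep l g f), (hq g).ae (hs f)] with p h1 h2 h3 h4
  have h5 : actH g (actH s p) = actH s (actH g p) := by
    simp only [actH, Prod.mk.injEq]
    constructor <;> ring
  rw [h1, h3, h2, h4, h5]
  congr 1
  rw [coe_character_master, coe_character_master, ← h, hμ, hb, hc, hb', hc']
  congr 3
  congr 1
  simp only [actH, s]
  linear_combination g.a2 * hq2 - (g.a3 + g.a2 * (p.1 + g.a1)) * hq1

/-! ### Integration over the plane by unit cells -/

/-- The cell `[0,1)² + a`. -/
def cellAt (a : ℤ × ℤ) : Set (ℝ × ℝ) := {p | ⌊p.1⌋ = a.1 ∧ ⌊p.2⌋ = a.2}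

/-- The translation of the plane by an integral vector. -/
def shift (a : ℤ × ℤ) (p : ℝ × ℝ) : ℝ × ℝ := (p.1 + a.1, p.2 + a.2)

theorem measurableSet_cellAt (a : ℤ × ℤ) : MeasurableSet (cellAt a) :=
  ((Int.measurable_floor.comp measurable_fst) (measurableSet_singleton a.1)).inter
    ((Int.measurable_floor.comp measurable_snd) (measurableSet_singleton a.2))

theorem iUnion_cellAt : ⋃ a, cellAt a = Set.univ :=
  Set.eq_univ_of_forall fun p => Set.mem_iUnion.2 ⟨(⌊p.1⌋, ⌊p.2⌋), rfl, rfl⟩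

theorem pairwise_disjoint_cellAt : Pairwise (Function.onFun Disjoint cellAt) := by
  intro a b hab
  refine Set.disjoint_left.2 fun p hp hq => hab ?_
  exact Prod.ext (hp.1.symm.trans hq.1) (hp.2.symm.trans hq.2)

theorem shift_mem_cellAt {a : ℤ × ℤ} {p : ℝ × ℝ} : shift a p ∈ cellAt a ↔ p ∈ cellAt 0 := by
  simp [shift, cellAt]

theorem measurePreserving_shift (a : ℤ × ℤ) : MeasurePreserving (shift a)
    ((volume : Measure (ℝ × ℝ)).restrict (cellAt 0)) (volume.restrict (cellAt a)) := by
  have h : MeasurePreserving (shift a) (volume : Measure (ℝ × ℝ)) volume :=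
    (measurePreserving_add_right volume (a.1 : ℝ)).prod (measurePreserving_add_right volume (a.2 : ℝ))
  convert h.restrict_preimage (measurableSet_cellAt a) using 2
  ext p
  exact shift_mem_cellAt.symm

theorem lintegral_eq_tsum_cellAt {F : ℝ × ℝ → ENNReal} (hF : Measurable F) :
    ∫⁻ p, F p = ∑' a : ℤ × ℤ, ∫⁻ p in cellAt 0, F (shift a p) := by
  rw [← setLIntegral_univ, ← iUnion_cellAt,
    lintegral_iUnion measurableSet_cellAt pairwise_disjoint_cellAt]
  exact tsum_congr fun a => ((measurePreserving_shift a).lintegral_comp hF).symm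

theorem ae_of_ae_cellAt {Q : ℝ × ℝ → Prop}
    (h : ∀ a : ℤ × ℤ, ∀ᵐ p ∂(volume.restrict (cellAt 0)), Q (shift a p)) : ∀ᵐ p, Q p := by
  rw [← Measure.restrict_univ (μ := (volume : Measure (ℝ × ℝ))), ← iUnion_cellAt,
    ae_restrict_iUnion_iff]
  intro a
  have hinv : MeasurePreserving (shift (-a))
      ((volume : Measure (ℝ × ℝ)).restrict (cellAt a)) (volume.restrict (cellAt 0)) := by
    have h : MeasurePreserving (shift (-a)) (volume : Measure (ℝ × ℝ)) volume :=
      (measurePreserving_add_right volume (((-a).1 : ℤ) : ℝ)).prod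
        (measurePreserving_add_right volume (((-a).2 : ℤ) : ℝ))
    convert h.restrict_preimage (measurableSet_cellAt 0) using 2
    ext p
    simp only [shift, cellAt, Set.mem_ofPred_eq, Set.mem_preimage, Int.floor_eq_iff, Prod.fst_neg,
      Prod.snd_neg, Int.cast_neg, Prod.fst_zero, Prod.snd_zero, Int.cast_zero]
    constructor <;> rintro ⟨⟨h1, h2⟩, h3, h4⟩ <;> refine ⟨⟨?_, ?_⟩, ?_, ?_⟩ <;> linarith
  filter_upwards [hinv.quasiMeasurePreserving.ae (h a)] with p hp
  convert hp
  simp [shift]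

/-! ### Coordinates on `P` in which `H⁰` acts by translations -/

/-- The Haar measure of total mass one. -/
local instance haarCircle : MeasureSpace UnitAddCircle := ⟨AddCircle.haarAddCircle⟩

local instance haarCircle_isAddHaarMeasure : (volume : Measure UnitAddCircle).IsAddHaarMeasure :=
  inferInstanceAs (Measure.IsAddHaarMeasure AddCircle.haarAddCircle)

local instance haarCircle_isProbabilityMeasure :
    IsProbabilityMeasure (volume : Measure UnitAddCircle) :=
  inferInstanceAs (IsProbabilityMeasure AddCircle.haarAddCircle)

/-- The three-dimensional torus, which is the quotient of `H⁰` by its integral points. -/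
abbrev Torus : Type := UnitAddTorus (Fin 3)

/-- The covering map of the torus. -/
def toTorus (x : Fin 3 → ℝ) : Torus := fun i => (x i : UnitAddCircle)

/-- The element of `H⁰` with coordinates `x 0`, `x 1`, `x 2 / 2`. -/
def elH (x : Fin 3 → ℝ) : Gt := ⟨0, x 0, x 1, 0, x 2 / 2⟩

theorem elH_add (x y : Fin 3 → ℝ) : elH (x + y) = elH x * elH y := by
  simp only [elH, Gt.mul_def, Pi.add_apply]
  ext <;> simp only <;> ring

/-- The representative in `[0,1)³` of a point of the torus. -/
def torusRep (τ : Torus) : Fin 3 → ℝ := fun i => (AddCircle.equivIco 1 0 (τ i) : ℝ)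

theorem toTorus_torusRep (τ : Torus) : toTorus (torusRep τ) = τ :=
  funext fun i => (AddCircle.equivIco 1 0).symm_apply_apply (τ i)

theorem measurable_torusRep : Measurable torusRep :=
  measurable_pi_lambda _ fun i =>
    measurable_subtype_coe.comp ((AddCircle.measurableEquivIco 1 0).measurable.comp
      (measurable_pi_apply i))

theorem toTorus_add (x y : Fin 3 → ℝ) : toTorus (x + y) = toTorus x + toTorus y := rfl

/-- The fibration of `P` over the plane, `(p, h) ↦ Γ̃ h s(p)`. -/
def theta (p : ℝ × ℝ) (τ : Torus) : P := toP (elH (torusRep τ) * sec p)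

/-- Any lift may replace the one in the unit cube: the two differ by an integral vector, whose image
under `elH` lies in `Gam` and is absorbed on the left. The halved last coordinate of `elH` matches
`v ∈ ½ℤ`. -/
theorem theta_toTorus (p : ℝ × ℝ) (x : Fin 3 → ℝ) : theta p (toTorus x) = toP (elH x * sec p) := by
  have h (i : Fin 3) : ∃ n : ℤ, x i = n + torusRep (toTorus x) i := by
    have h1 : ((torusRep (toTorus x) i : ℝ) : UnitAddCircle) = (x i : ℝ) :=
      congrFun (toTorus_torusRep (toTorus x)) i
    rw [eq_comm, ← sub_eq_zero, ← AddCircle.coe_sub, AddCircle.coe_eq_zero_iff] at h1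
    obtain ⟨n, hn⟩ := h1
    refine ⟨n, ?_⟩
    rw [zsmul_eq_mul, mul_one] at hn
    linarith
  choose n hn using h
  have hx : x = (fun i => (n i : ℝ)) + torusRep (toTorus x) := funext hn
  refine toP_eq_iff.2 ⟨⟨elH fun i => n i, ⟨0, by simp [elH]⟩, ⟨n 0, rfl⟩, ⟨n 1, rfl⟩,
    ⟨0, by simp [elH]⟩, ⟨n 2, rfl⟩⟩, ?_⟩
  conv_rhs => rw [hx]
  rw [elH_add, mul_assoc]

theorem measurable_theta : Measurable (Function.uncurry theta) := by
  have h1 : Measurable fun q : (ℝ × ℝ) × Torus => torusRep q.2 :=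
    measurable_torusRep.comp measurable_snd
  have h2 (i : Fin 3) : Measurable fun q : (ℝ × ℝ) × Torus => torusRep q.2 i :=
    (measurable_pi_apply i).comp h1
  have h0 := h2 0
  have h3 := h2 1
  have h4 := h2 2
  refine measurable_toP.comp ?_
  simp only [elH, sec, Gt.mul_def]
  refine Gt.measurable_mk ?_ ?_ ?_ ?_ ?_ <;> fun_prop

/-- The coordinates on the torus of the element `h(p, g)` of `H⁰`. -/
def masterCoords (g : Gt) (p : ℝ × ℝ) : Fin 3 → ℝ :=
  ![g.a2, g.a3 + g.a2 * (p.1 + g.a1),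
    2 * (g.v + p.2 * g.a2 - g.a3 * (p.1 + g.a1) - g.a2 * (p.1 + g.a1) ^ 2 / 2)]

theorem elH_masterCoords (g : Gt) (p : ℝ × ℝ) : elH (masterCoords g p) = master g p := by
  have h := logH0_master g p
  simp only [logH0, Gt.coords, Equiv.coe_fn_mk, Prod.mk.injEq] at h
  obtain ⟨h1, h2, h3, h4, h5⟩ := h
  ext
  · rw [h1]; rfl
  · rw [h2]; rfl
  · rw [h3]; rfl
  · rw [h4]; rfl
  · rw [h5]
    simp [elH, masterCoords]

/-- Moving `g` past the section produces the factor `h(p, g)`, which merges with the torus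
coordinate because `elH` is additive. -/
theorem actP_theta (g : Gt) (p : ℝ × ℝ) (τ : Torus) :
    actP g (theta p τ) = theta (actH g p) (τ + toTorus (masterCoords g p)) := by
  rw [← toTorus_torusRep τ, ← toTorus_add, theta_toTorus, theta_toTorus, actP_toP, mul_assoc,
    sec_mul, elH_add, elH_masterCoords, mul_assoc]

/-- This reduces measure statements over any cell to the unit cell, since `actP` preserves `volP`.
-/
theorem theta_shift_eq_actP (a : ℤ × ℤ) (p : ℝ × ℝ) (τ : Torus) :
    theta (shift a p) τ = actP ⟨a.1, 0, 0, a.2, 0⟩ (theta p τ) := by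
  have h : masterCoords ⟨a.1, 0, 0, a.2, 0⟩ p = 0 := by
    ext i
    fin_cases i <;> simp [masterCoords]
  rw [actP_theta, h]
  have : toTorus 0 = 0 := rfl
  rw [this, add_zero]
  rfl

/-- The automorphism of the torus induced by the conjugation with `(a, 0, 0, b, 0)`. -/
def torusAut (a : ℤ × ℤ) : Torus →+ Torus where
  toFun τ := ![τ 0, τ 1 - a.1 • τ 0, τ 2 + (2 * a.1) • τ 1 - (2 * a.2 + a.1 ^ 2) • τ 0]
  map_zero' := by
    ext i
    fin_cases i <;> simp
  map_add' σ τ := by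
    ext i
    fin_cases i
    · simp
    · simp [smul_add]
      abel
    · simp [smul_add]
      abel

theorem torusAut_toTorus (a : ℤ × ℤ) (x : Fin 3 → ℝ) : torusAut a (toTorus x) = toTorus
    ![x 0, x 1 - a.1 * x 0, x 2 + (2 * a.1) * x 1 - (2 * a.2 + a.1 ^ 2) * x 0] := by
  ext i
  fin_cases i
  · rfl
  · change (x 1 : UnitAddCircle) - a.1 • (x 0 : UnitAddCircle) = (_ : ℝ)
    rw [← AddCircle.coe_zsmul, ← AddCircle.coe_sub]
    simp
  · change (x 2 : UnitAddCircle) + (2 * a.1) • (x 1 : UnitAddCircle) -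
      (2 * a.2 + a.1 ^ 2) • (x 0 : UnitAddCircle) = (_ : ℝ)
    rw [← AddCircle.coe_zsmul, ← AddCircle.coe_zsmul, ← AddCircle.coe_add, ← AddCircle.coe_sub]
    simp

/-- The integral element now stands on the left, where `Gam` absorbs it; passing it through the `H0`
factor conjugates that factor, which is `torusAut`. -/
theorem theta_shift (a : ℤ × ℤ) (p : ℝ × ℝ) (τ : Torus) :
    theta (shift a p) τ = theta p (torusAut a τ) := by
  obtain ⟨x, rfl⟩ : ∃ x, τ = toTorus x := ⟨_, (toTorus_torusRep τ).symm⟩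
  rw [torusAut_toTorus, theta_toTorus, theta_toTorus, eq_comm, toP_eq_iff]
  refine ⟨⟨⟨a.1, 0, 0, a.2, 0⟩, ⟨a.1, rfl⟩, ⟨0, by simp⟩, ⟨0, by simp⟩, ⟨a.2, rfl⟩, 0, by simp⟩, ?_⟩
  simp only [elH, sec, shift, Gt.mul_def]
  ext <;> simp <;> ring

/-- A continuous surjective endomorphism of a compact group preserves normalised Haar measure;
unipotence gives explicit preimages. -/
theorem measurePreserving_torusAut (a : ℤ × ℤ) :
    MeasurePreserving (torusAut a) (volume : Measure Torus) volume := by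
  refine AddMonoidHom.measurePreserving ?_ ?_ rfl
  · refine continuous_pi fun i => ?_
    fin_cases i
    · change Continuous fun τ : Torus => τ 0
      fun_prop
    · change Continuous fun τ : Torus => τ 1 - a.1 • τ 0
      fun_prop
    · change Continuous fun τ : Torus =>
        τ 2 + (2 * a.1) • τ 1 - (2 * a.2 + a.1 ^ 2) • τ 0
      fun_prop
  · intro τ
    refine ⟨![τ 0, τ 1 + a.1 • τ 0,
      τ 2 - (2 * a.1) • (τ 1 + a.1 • τ 0) + (2 * a.2 + a.1 ^ 2) • τ 0], ?_⟩
    ext i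
    fin_cases i
    · rfl
    · exact add_sub_cancel_right _ _
    · change τ 2 - (2 * a.1) • (τ 1 + a.1 • τ 0) + (2 * a.2 + a.1 ^ 2) • τ 0 +
        (2 * a.1) • (τ 1 + a.1 • τ 0) - (2 * a.2 + a.1 ^ 2) • τ 0 = τ 2
      generalize (2 * a.1) • (τ 1 + a.1 • τ 0) = u
      generalize (2 * a.2 + a.1 ^ 2) • τ 0 = w
      abel

/-! ### The invariant measure of `P` in the coordinates of the fibration -/

/-- The linear part of the coordinates `(p, h) ↦ h s(p)`. -/
def linearCoords : ((ℝ × ℝ) × (Fin 3 → ℝ)) ≃L[ℝ] ℝ × ℝ × ℝ × ℝ × ℝ :=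
  LinearEquiv.toContinuousLinearEquiv
    { toFun := fun q => (q.1.1, q.2 0, q.2 1, q.1.2, q.2 2 / 2)
      invFun := fun q => ((q.1, q.2.2.2.1), ![q.2.1, q.2.2.1, 2 * q.2.2.2.2])
      map_add' := fun q q' => by simp [add_div]
      map_smul' := fun c q => by simp [mul_div_assoc]
      left_inv := fun q => by
        ext i
        · rfl
        · rfl
        · fin_cases i
          · rfl
          · rfl
          · simp
            ring
      right_inv := fun q => by simp }

/-- By uniqueness of Haar measure one box determines the factor: `B` has volume 1/2 and its preimage
is a unit cube. -/
theorem map_linearCoords : Measure.map linearCoords (volume : Measure ((ℝ × ℝ) × (Fin 3 → ℝ))) =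
    (2 : ENNReal) • volume := by
  have i1 : (volume : Measure (ℝ × ℝ)).IsAddHaarMeasure :=
    Measure.prod.instIsAddHaarMeasure volume volume
  have i2 : (volume : Measure ((ℝ × ℝ) × (Fin 3 → ℝ))).IsAddHaarMeasure :=
    Measure.prod.instIsAddHaarMeasure volume volume
  have i3 : (volume : Measure (ℝ × ℝ × ℝ)).IsAddHaarMeasure :=
    Measure.prod.instIsAddHaarMeasure volume volume
  have i4 : (volume : Measure (ℝ × ℝ × ℝ × ℝ)).IsAddHaarMeasure :=
    Measure.prod.instIsAddHaarMeasure volume volume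
  have i5 : (volume : Measure (ℝ × ℝ × ℝ × ℝ × ℝ)).IsAddHaarMeasure :=
    Measure.prod.instIsAddHaarMeasure volume volume
  have hH := linearCoords.isAddHaarMeasure_map (volume : Measure ((ℝ × ℝ) × (Fin 3 → ℝ)))
  have hc := Measure.isAddLeftInvariant_eq_smul
    (Measure.map linearCoords (volume : Measure ((ℝ × ℝ) × (Fin 3 → ℝ)))) volume
  generalize Measure.addHaarScalarFactor
    (Measure.map linearCoords (volume : Measure ((ℝ × ℝ) × (Fin 3 → ℝ)))) volume = c at hc
  obtain ⟨B, hB⟩ : ∃ B, B = Set.Icc (0 : ℝ) 1 ×ˢ Set.Icc (0 : ℝ) 1 ×ˢ Set.Icc (0 : ℝ) 1 ×ˢ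
    Set.Icc (0 : ℝ) 1 ×ˢ Set.Icc (0 : ℝ) (1 / 2) := ⟨_, rfl⟩
  have hBm : MeasurableSet B := by
    rw [hB]
    measurability
  have h2 : linearCoords ⁻¹' B =
      (Set.Icc (0 : ℝ) 1 ×ˢ Set.Icc (0 : ℝ) 1) ×ˢ Set.pi Set.univ fun _ => Set.Icc (0 : ℝ) 1 := by
    rw [hB]
    ext q
    change (q.1.1 ∈ Set.Icc (0 : ℝ) 1 ∧ q.2 0 ∈ Set.Icc (0 : ℝ) 1 ∧ q.2 1 ∈ Set.Icc (0 : ℝ) 1 ∧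
      q.1.2 ∈ Set.Icc (0 : ℝ) 1 ∧ q.2 2 / 2 ∈ Set.Icc (0 : ℝ) (1 / 2)) ↔
      (q.1.1 ∈ Set.Icc (0 : ℝ) 1 ∧ q.1.2 ∈ Set.Icc (0 : ℝ) 1) ∧
        ∀ i, i ∈ Set.univ → q.2 i ∈ Set.Icc (0 : ℝ) 1
    have e : q.2 2 / 2 ∈ Set.Icc (0 : ℝ) (1 / 2) ↔ q.2 2 ∈ Set.Icc (0 : ℝ) 1 := by
      simp only [Set.mem_Icc]
      constructor <;> rintro ⟨h, h'⟩ <;> constructor <;> linarith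
    simp only [e, Set.mem_univ, forall_true_left, Fin.forall_fin_succ (n := 2),
      Fin.forall_fin_two]
    change _ ↔ _ ∧ q.2 0 ∈ Set.Icc (0 : ℝ) 1 ∧ q.2 1 ∈ Set.Icc (0 : ℝ) 1 ∧
      q.2 2 ∈ Set.Icc (0 : ℝ) 1
    tauto
  have h1 := congrArg (fun μ => μ B) hc
  simp only [Measure.smul_apply] at h1
  rw [Measure.map_apply linearCoords.continuous.measurable hBm, h2, hB] at h1
  simp only [Measure.volume_eq_prod, Measure.prod_prod, Real.volume_Icc, volume_pi_pi] at h1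
  have h3 : c = 2 := by
    have h4 : (1 : ENNReal) = c * ENNReal.ofReal (1 / 2) := by simpa [ENNReal.smul_def] using h1
    have h5 := congrArg ENNReal.toReal h4
    rw [ENNReal.toReal_mul, ENNReal.toReal_ofReal (by norm_num), ENNReal.toReal_one,
      ENNReal.coe_toReal] at h5
    have h6 : (c : ℝ) = 2 := by linarith
    exact_mod_cast h6
  rw [hc, h3]
  rfl

/-- The point `h s(p)` of the group. -/
def param (q : (ℝ × ℝ) × (Fin 3 → ℝ)) : Gt := elH q.2 * sec q.1

theorem measurable_param : Measurable param := by
  have h0 : Measurable fun q : (ℝ × ℝ) × (Fin 3 → ℝ) => q.2 0 := by fun_prop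
  have h1 : Measurable fun q : (ℝ × ℝ) × (Fin 3 → ℝ) => q.2 1 := by fun_prop
  have h2 : Measurable fun q : (ℝ × ℝ) × (Fin 3 → ℝ) => q.2 2 := by fun_prop
  unfold param
  simp only [elH, sec, Gt.mul_def]
  refine Gt.measurable_mk ?_ ?_ ?_ ?_ ?_ <;> fun_prop

/-- `param` is `linearCoords` followed by a triangular shear that preserves volume, so the factor 2
is that of the linear part. -/
theorem map_param : Measure.map param volume = (2 : ENNReal) • (volume : Measure Gt) := by
  have h1 := Gt.measurePreserving_triangular 0 0 0 (fun x y => -(y * x))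
    (fun x y z _ => z * x - y * x ^ 2 / 2) (by fun_prop) (by fun_prop)
  have h2 := h1.comp (MeasurePreserving.symm _ Gt.measurePreserving_measEquiv)
  have h3 : param = (fun g : Gt => (⟨g.a1 + 0, g.a2 + 0, g.a3 + -(g.a2 * g.a1), g.r + 0,
      g.v + (g.a3 * g.a1 - g.a2 * g.a1 ^ 2 / 2)⟩ : Gt)) ∘ Gt.measEquiv.symm ∘ linearCoords := by
    funext q
    change (⟨_, _, _, _, _⟩ : Gt) = ⟨_, _, _, _, _⟩
    simp only [elH, sec]
    ext
    · exact add_comm _ _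
    · rfl
    · change q.2 1 + 0 - q.2 0 * q.1.1 = q.2 1 + -(q.2 0 * q.1.1)
      ring
    · exact add_comm _ _
    · change q.2 2 / 2 + 0 + q.2 1 * q.1.1 - q.2 0 * q.1.1 ^ 2 / 2 + 0 * 0 =
        q.2 2 / 2 + (q.2 1 * q.1.1 - q.2 0 * q.1.1 ^ 2 / 2)
      ring
  rw [h3, ← Function.comp_assoc, ← Measure.map_map h2.measurable
    linearCoords.continuous.measurable, map_linearCoords, Measure.map_smul, h2.map_eq]

/-- The fundamental domain of `Γ̃` adapted to the fibration. -/
def domainH : Set Gt :=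
  -- These are the inverse coordinates of `param`. The torus coordinates use `Ioc`, the intervals of
  -- `UnitAddTorus.lintegral_preimage`; the plane uses `Ico`, to match `cellAt`.
  {g | g.a1 ∈ Set.Ico (0 : ℝ) 1 ∧ g.r ∈ Set.Ico (0 : ℝ) 1 ∧ g.a2 ∈ Set.Ioc (0 : ℝ) 1 ∧
    g.a3 + g.a2 * g.a1 ∈ Set.Ioc (0 : ℝ) 1 ∧
    2 * (g.v - g.a3 * g.a1 - g.a2 * g.a1 ^ 2 / 2) ∈ Set.Ioc (0 : ℝ) 1}

theorem measurableSet_domainH : MeasurableSet domainH := by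
  have h1 := Gt.measurable_a1
  have h2 := Gt.measurable_a2
  have h3 := Gt.measurable_a3
  have h4 := Gt.measurable_v
  have h5 : Measurable fun g : Gt => g.a3 + g.a2 * g.a1 := by fun_prop
  have h6 : Measurable fun g : Gt => 2 * (g.v - g.a3 * g.a1 - g.a2 * g.a1 ^ 2 / 2) := by fun_prop
  exact (h1 measurableSet_Ico).inter ((Gt.measurable_r measurableSet_Ico).inter
    ((h2 measurableSet_Ioc).inter ((h5 measurableSet_Ioc).inter (h6 measurableSet_Ioc))))

theorem param_mem_domainH (q : (ℝ × ℝ) × (Fin 3 → ℝ)) :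
    param q ∈ domainH ↔ q.1 ∈ cellAt 0 ∧ ∀ i, q.2 i ∈ Set.Ioc (0 : ℝ) 1 := by
  have e1 : (param q).a1 = q.1.1 := zero_add _
  have e2 : (param q).a2 = q.2 0 := add_zero _
  have e3 : (param q).a3 = q.2 1 - q.2 0 * q.1.1 := by
    change q.2 1 + 0 - q.2 0 * q.1.1 = _
    ring
  have e4 : (param q).r = q.1.2 := zero_add _
  have e5 : (param q).v = q.2 2 / 2 + q.2 1 * q.1.1 - q.2 0 * q.1.1 ^ 2 / 2 := by
    change q.2 2 / 2 + 0 + q.2 1 * q.1.1 - q.2 0 * q.1.1 ^ 2 / 2 + 0 * 0 = _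
    ring
  have e6 : q.2 1 - q.2 0 * q.1.1 + q.2 0 * q.1.1 = q.2 1 := by ring
  have e7 : 2 * (q.2 2 / 2 + q.2 1 * q.1.1 - q.2 0 * q.1.1 ^ 2 / 2 -
      (q.2 1 - q.2 0 * q.1.1) * q.1.1 - q.2 0 * q.1.1 ^ 2 / 2) = q.2 2 := by ring
  have e8 (x : ℝ) : x ∈ Set.Ico (0 : ℝ) 1 ↔ ⌊x⌋ = 0 := by simp
  change (_ ∧ _ ∧ _ ∧ _ ∧ _) ↔ _
  rw [e1, e2, e3, e4, e5, e6, e7, Fin.forall_fin_succ, Fin.forall_fin_two, e8, e8]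
  exact and_assoc.symm

theorem existsUnique_int_Ioc (x : ℝ) : ∃! n : ℤ, (n : ℝ) + x ∈ Set.Ioc (0 : ℝ) 1 := by
  simpa [add_comm] using existsUnique_add_zsmul_mem_Ioc (zero_lt_one' ℝ) x 0

/-- The group law is triangular, so the integers are determined uniquely one at a time, in the order
`a1`, `r`, `a2`, `a3`, `v`. -/
theorem isFundamentalDomain_domainH : IsFundamentalDomain Gam domainH := by
  refine IsFundamentalDomain.mk' measurableSet_domainH.nullMeasurableSet ?_
  intro g
  obtain ⟨x, hx, ux⟩ := existsUnique_int g.a1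
  obtain ⟨t, ht, ut⟩ := existsUnique_int g.r
  obtain ⟨y, hy, uy⟩ := existsUnique_int_Ioc g.a2
  obtain ⟨z, hz, uz⟩ := existsUnique_int_Ioc (g.a3 - y * g.a1 + (y + g.a2) * (x + g.a1))
  obtain ⟨v, hv, uv⟩ := existsUnique_int_Ioc (2 * (g.v + z * g.a1 - y * g.a1 ^ 2 / 2 + t * g.a2 -
    (z + g.a3 - y * g.a1) * (x + g.a1) - (y + g.a2) * (x + g.a1) ^ 2 / 2))
  refine ⟨⟨⟨x, y, z, t, v / 2⟩, ⟨x, rfl⟩, ⟨y, rfl⟩, ⟨z, rfl⟩, ⟨t, rfl⟩, ⟨v, rfl⟩⟩, ?_, ?_⟩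
  · change (⟨x, y, z, t, v / 2⟩ : Gt) * g ∈ domainH
    rw [Gt.mul_def]
    refine ⟨hx, ht, hy, ?_, ?_⟩
    · convert hz using 1
      simp only
      ring
    · convert hv using 1
      simp only
      ring
  · rintro ⟨c, ⟨x', hx'⟩, ⟨y', hy'⟩, ⟨z', hz'⟩, ⟨t', ht'⟩, ⟨v', hv'⟩⟩ hc
    change c * g ∈ domainH at hc
    rw [Gt.mul_def] at hc
    obtain ⟨h1, h2, h3, h4, h5⟩ := hc
    simp only [hx', hy', hz', ht', hv'] at h1 h2 h3 h4 h5
    obtain rfl := ux x' h1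
    obtain rfl := ut t' h2
    obtain rfl := uy y' h3
    obtain rfl := uz z' (by convert h4 using 1; ring)
    obtain rfl := uv v' (by convert h5 using 1; ring)
    apply Subtype.ext
    ext <;> assumption

/-- The fibration transports the product measure on a cell to twice the measure of `P`. -/
theorem lintegral_theta {F : P → ENNReal} (hF : Measurable F) :
    ∫⁻ p in cellAt 0, ∫⁻ τ, F (theta p τ) = 2 * ∫⁻ x, F x ∂volP := by
  have hFm : Measurable (fun q => F (toP (param q))) :=
    hF.comp (measurable_toP.comp measurable_param)
  have : Countable Gam := countable_Gam
  calc ∫⁻ p in cellAt 0, ∫⁻ τ, F (theta p τ)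
      = ∫⁻ p in cellAt 0, ∫⁻ x in {x : Fin 3 → ℝ | ∀ i, x i ∈ Set.Ioc ((0 : Fin 3 → ℝ) i)
          ((0 : Fin 3 → ℝ) i + 1)}, F (toP (param (p, x))) := by
        refine lintegral_congr fun p => ?_
        rw [UnitAddTorus.lintegral_preimage _ 0]
        refine lintegral_congr fun x => ?_
        exact congrArg F (theta_toTorus p x)
    _ = ∫⁻ q in cellAt 0 ×ˢ {x : Fin 3 → ℝ | ∀ i, x i ∈ Set.Ioc ((0 : Fin 3 → ℝ) i)
          ((0 : Fin 3 → ℝ) i + 1)}, F (toP (param q)) := by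
        rw [Measure.volume_eq_prod (ℝ × ℝ), ← Measure.prod_restrict,
          lintegral_prod _ hFm.aemeasurable]
    _ = ∫⁻ q in param ⁻¹' domainH, F (toP (param q)) := by
        congr 2
        ext q
        rw [Set.mem_preimage, param_mem_domainH]
        simp
    _ = ∫⁻ g in domainH, F (toP g) ∂((2 : ENNReal) • (volume : Measure Gt)) := by
        rw [← map_param]
        exact (setLIntegral_map measurableSet_domainH (hF.comp measurable_toP)
          measurable_param).symm
    _ = 2 * ∫⁻ g in domainH, F (toP g) := by
        rw [Measure.restrict_smul, lintegral_smul_measure, smul_eq_mul]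
    -- The integrand is invariant under `Gam`, so all fundamental domains give the same integral.
    _ = 2 * ∫⁻ g in domainP, F (toP g) := by
        rw [isFundamentalDomain_domainH.setLIntegral_eq isFundamentalDomain_domainP]
        intro c g
        exact congrArg F (toP_eq_iff.2 ⟨c, rfl⟩).symm
    _ = 2 * ∫⁻ x, F x ∂volP := by
        rw [volP, lintegral_map hF measurable_toP]

/-- Infinitely many cells cover `P`, so only null sets are controlled; a null set is tested on each
cell after translation to the unit cell. -/
theorem quasiMeasurePreserving_theta :
    Measure.QuasiMeasurePreserving (Function.uncurry theta) (volume.prod volume) volP := by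
  refine ⟨measurable_theta, Measure.AbsolutelyContinuous.mk fun S hS h0 => ?_⟩
  rw [Measure.map_apply measurable_theta hS, Measure.prod_apply (measurable_theta hS),
    lintegral_eq_tsum_cellAt (measurable_measure_prodMk_left (measurable_theta hS)),
    ENNReal.tsum_eq_zero]
  intro a
  have h1 := measurePreserving_actP ⟨a.1, 0, 0, a.2, 0⟩
  have hSa := h1.measurable hS
  have h2 := lintegral_theta (F := (actP ⟨a.1, 0, 0, a.2, 0⟩ ⁻¹' S).indicator 1)
    (measurable_one.indicator hSa)
  rw [lintegral_indicator_one hSa, h1.measure_preimage hS.nullMeasurableSet, h0, mul_zero] at h2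
  rw [← h2]
  refine lintegral_congr fun p => ?_
  have h3 : MeasurableSet ((theta p) ⁻¹' (actP ⟨a.1, 0, 0, a.2, 0⟩ ⁻¹' S)) :=
    (measurable_theta.comp measurable_prodMk_left) hSa
  rw [show (fun τ => (actP ⟨a.1, 0, 0, a.2, 0⟩ ⁻¹' S).indicator (1 : P → ENNReal) (theta p τ)) =
    ((theta p) ⁻¹' (actP ⟨a.1, 0, 0, a.2, 0⟩ ⁻¹' S)).indicator 1 from rfl,
    lintegral_indicator_one h3]
  congr 1
  ext τ
  simp only [Set.mem_preimage, Function.uncurry_apply_pair, theta_shift_eq_actP]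

theorem ae_ae_theta {Q : P → Prop} (h : ∀ᵐ x ∂volP, Q x) : ∀ᵐ p : ℝ × ℝ, ∀ᵐ τ, Q (theta p τ) :=
  Measure.ae_ae_of_ae_prod (quasiMeasurePreserving_theta.ae h)

/-- Almost every fibre of a square-integrable function is square-integrable. -/
theorem ae_memLp_theta (f : Lp ℂ 2 volP) : ∀ᵐ p : ℝ × ℝ, MemLp (fun τ => f (theta p τ)) 2 := by
  have hf := (Lp.stronglyMeasurable f).measurable
  refine ae_of_ae_cellAt fun a => ?_
  have h1 := measurePreserving_actP ⟨a.1, 0, 0, a.2, 0⟩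
  have hm : Measurable fun x => ‖f (actP ⟨a.1, 0, 0, a.2, 0⟩ x)‖ₑ ^ 2 :=
    ((hf.comp h1.measurable).enorm).pow_const 2
  have h2 := lintegral_theta hm
  have h3 : ∫⁻ x, ‖f (actP ⟨a.1, 0, 0, a.2, 0⟩ x)‖ₑ ^ 2 ∂volP < ⊤ := by
    have h4 : MemLp (fun x => f (actP ⟨a.1, 0, 0, a.2, 0⟩ x)) 2 volP :=
      (Lp.memLp f).comp_measurePreserving h1
    have h5 := lintegral_rpow_enorm_lt_top_of_eLpNorm_lt_top two_ne_zero ENNReal.ofNat_ne_top h4.2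
    simpa using h5
  have h6 : ∫⁻ p in cellAt 0, ∫⁻ τ, ‖f (actP ⟨a.1, 0, 0, a.2, 0⟩ (theta p τ))‖ₑ ^ 2 ≠ ⊤ := by
    rw [h2]
    exact (ENNReal.mul_lt_top ENNReal.ofNat_lt_top h3).ne
  have h7 : Measurable fun p : ℝ × ℝ =>
      ∫⁻ τ, ‖f (actP ⟨a.1, 0, 0, a.2, 0⟩ (theta p τ))‖ₑ ^ 2 :=
    (hm.comp measurable_theta).lintegral_prod_right'
  filter_upwards [ae_lt_top h7 h6] with p hp
  have h8 : Measurable fun τ => f (theta (shift a p) τ) :=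
    hf.comp (measurable_theta.comp measurable_prodMk_left)
  refine ⟨h8.aestronglyMeasurable, ?_⟩
  rw [eLpNorm_lt_top_iff_lintegral_rpow_enorm_lt_top two_ne_zero ENNReal.ofNat_ne_top]
  simp only [theta_shift_eq_actP]
  simpa using hp

open UnitAddTorus

/-! ### Fourier coefficients along the fibres -/

theorem mFourier_toTorus (ν : Fin 3 → ℤ) (x : Fin 3 → ℝ) : mFourier ν (toTorus x) =
    Complex.exp (2 * Real.pi * Complex.I * (ν 0 * x 0 + ν 1 * x 1 + ν 2 * x 2)) := by
  change ∏ i, fourier (ν i) ((x i : ℝ) : UnitAddCircle) = _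
  simp only [fourier_coe_apply, Fin.prod_univ_three, ← Complex.exp_add]
  congr 1
  push_cast
  ring

theorem mFourier_neg_mul_self (ν : Fin 3 → ℤ) (τ : Torus) :
    mFourier (-ν) τ * mFourier ν τ = 1 := by
  rw [← mFourier_add, neg_add_cancel, mFourier_zero]
  rfl

theorem mFourier_apply_add (ν : Fin 3 → ℤ) (σ τ : Torus) :
    mFourier ν (σ + τ) = mFourier ν σ * mFourier ν τ := by
  rw [← toTorus_torusRep σ, ← toTorus_torusRep τ, ← toTorus_add, mFourier_toTorus,
    mFourier_toTorus, mFourier_toTorus, ← Complex.exp_add]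
  congr 1
  simp only [Pi.add_apply]
  push_cast
  ring

/-- The action of integral translations of the plane on the frequencies. -/
def shiftFreq (a : ℤ × ℤ) (ν : Fin 3 → ℤ) : Fin 3 → ℤ :=
  ![ν 0 + ν 1 * a.1 + ν 2 * (2 * a.2 - a.1 ^ 2), ν 1 - 2 * a.1 * ν 2, ν 2]

/-- `shiftFreq a` is the inverse transpose of `torusAut a`, so the pairing of frequency and point is
unchanged. -/
theorem mFourier_shiftFreq (a : ℤ × ℤ) (ν : Fin 3 → ℤ) (τ : Torus) :
    mFourier (-shiftFreq a ν) (torusAut a τ) = mFourier (-ν) τ := by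
  obtain ⟨x, rfl⟩ : ∃ x, τ = toTorus x := ⟨_, (toTorus_torusRep τ).symm⟩
  rw [torusAut_toTorus, mFourier_toTorus, mFourier_toTorus]
  congr 1
  simp [shiftFreq]
  ring

/-- The Fourier coefficients of a function on `P` along the fibres over the plane. -/
def coef (f : P → ℂ) (ν : Fin 3 → ℤ) (p : ℝ × ℝ) : ℂ := mFourierCoeff (fun τ => f (theta p τ)) ν

theorem measurable_fibre {f : P → ℂ} (hf : Measurable f) (p : ℝ × ℝ) :
    Measurable fun τ => f (theta p τ) :=
  hf.comp (measurable_theta.comp measurable_prodMk_left)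

theorem measurable_coef {f : P → ℂ} (hf : Measurable f) (ν : Fin 3 → ℤ) :
    Measurable (coef f ν) := by
  have h1 : Measurable fun q : (ℝ × ℝ) × Torus => mFourier (-ν) q.2 • f (theta q.1 q.2) :=
    ((mFourier (-ν)).continuous.measurable.comp measurable_snd).smul (hf.comp measurable_theta)
  exact (h1.stronglyMeasurable.integral_prod_right' (ν := volume)).measurable

theorem coef_congr {f f' : P → ℂ} (h : f =ᵐ[volP] f') (ν : Fin 3 → ℤ) :
    coef f ν =ᵐ[volume] coef f' ν := by
  filter_upwards [ae_ae_theta h] with p hp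
  refine integral_congr_ae ?_
  filter_upwards [hp] with τ hτ
  rw [hτ]

theorem integrable_fibre {f : Torus → ℂ} (hf : MemLp f 2) (ν : Fin 3 → ℤ) :
    Integrable fun τ => mFourier (-ν) τ • f τ := by
  refine (hf.integrable (by norm_num)).bdd_mul (c := ‖mFourier (-ν)‖)
    (mFourier (-ν)).continuous.aestronglyMeasurable ?_
  filter_upwards with τ
  exact (mFourier (-ν)).norm_coe_le_norm τ

theorem coef_add (f f' : Lp ℂ 2 volP) (ν : Fin 3 → ℤ) :
    coef (f + f' : Lp ℂ 2 volP) ν =ᵐ[volume] fun p => coef f ν p + coef f' ν p := by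
  filter_upwards [coef_congr (Lp.coeFn_add f f') ν, ae_memLp_theta f, ae_memLp_theta f']
    with p h1 h2 h3
  rw [h1]
  simp only [coef, mFourierCoeff]
  rw [← integral_add (integrable_fibre h2 ν) (integrable_fibre h3 ν)]
  simp only [Pi.add_apply, smul_add]

theorem coef_smul (c : ℂ) (f : Lp ℂ 2 volP) (ν : Fin 3 → ℤ) :
    coef (c • f : Lp ℂ 2 volP) ν =ᵐ[volume] fun p => c * coef f ν p := by
  filter_upwards [coef_congr (Lp.coeFn_smul c f) ν] with p h1
  rw [h1]
  simp only [coef, mFourierCoeff]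
  rw [← integral_const_mul]
  refine integral_congr_ae ?_
  filter_upwards with τ
  simp only [Pi.smul_apply, smul_eq_mul]
  ring

/-- Change of variables by `torusAut a` on the fibre. This is the relation that identifies
coefficients along an orbit of frequencies. -/
theorem coef_shift {f : P → ℂ} (hf : Measurable f) (ν : Fin 3 → ℤ) (a : ℤ × ℤ) (p : ℝ × ℝ) :
    coef f ν (shift a p) = coef f (shiftFreq a ν) p := by
  have h := measurePreserving_torusAut a
  have hm : Measurable fun τ => mFourier (-shiftFreq a ν) τ • f (theta p τ) :=
    (mFourier (-shiftFreq a ν)).continuous.measurable.smul (measurable_fibre hf p)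
  simp only [coef, mFourierCoeff]
  conv_rhs => rw [← h.map_eq]
  rw [integral_map h.measurable.aemeasurable hm.aestronglyMeasurable]
  simp only [mFourier_shiftFreq, theta_shift]

/-- On the fibre `g` acts as a translation, which invariance of Haar measure turns into a character
value. -/
theorem coef_actP {f : P → ℂ} (ν : Fin 3 → ℤ) (g : Gt) (p : ℝ × ℝ) :
    coef (fun x => f (actP g x)) ν p =
      mFourier ν (toTorus (masterCoords g p)) * coef f ν (actH g p) := by
  simp only [coef, mFourierCoeff, actP_theta]
  rw [← integral_const_mul, ← integral_add_right_eq_self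
    (fun τ => mFourier ν (toTorus (masterCoords g p)) * mFourier (-ν) τ • f (theta (actH g p) τ))
    (toTorus (masterCoords g p))]
  refine integral_congr_ae ?_
  filter_upwards with τ
  rw [mFourier_apply_add]
  simp only [smul_eq_mul]
  linear_combination -(mFourier (-ν) τ * f (theta (actH g p) (τ + toTorus (masterCoords g p)))) *
    mFourier_neg_mul_self ν (toTorus (masterCoords g p))

theorem coeFn_rho (g : Gt) (f : Lp ℂ 2 volP) : ⇑(rho g f) =ᵐ[volP] fun x => f (actP g x) := by
  filter_upwards [CocycleAction.coeFn_rep _ g f] with x hx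
  refine hx.trans ?_
  simp

theorem coef_rho (g : Gt) (f : Lp ℂ 2 volP) (ν : Fin 3 → ℤ) : coef (rho g f) ν =ᵐ[volume]
    fun p => mFourier ν (toTorus (masterCoords g p)) * coef f ν (actH g p) := by
  filter_upwards [coef_congr (coeFn_rho g f) ν] with p hp
  rw [hp, coef_actP]

/-- Functions of central character `k` have only frequencies `-k` in the central direction. -/
theorem coef_eq_zero {k : ℤ} {f : Lp ℂ 2 volP} (hf : f ∈ L2k k) {ν : Fin 3 → ℤ}
    (hν : ν 2 ≠ -k) : coef f ν =ᵐ[volume] 0 := by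
  have hd : ((ν 2 : ℝ) + k) ≠ 0 := by
    intro h
    apply hν
    have : ν 2 + k = 0 := by exact_mod_cast h
    linarith
  -- With this `s` the two central characters differ by the factor `exp(iπ) = -1`, so the
  -- coefficient equals its own negative.
  let s : ℝ := 1 / (4 * (ν 2 + k))
  have h1 := coef_smul (Circle.exp (-(4 * Real.pi * k * s)) : ℂ) f ν
  have h2 := coef_rho (center s) f ν
  rw [hf s] at h2
  filter_upwards [h1, h2] with p h1 h2
  have h3 : actH (center s) p = p := by simp [actH, center]
  have h4 : mFourier ν (toTorus (masterCoords (center s) p)) =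
      Complex.exp (Real.pi * Complex.I) * Circle.exp (-(4 * Real.pi * k * s)) := by
    rw [mFourier_toTorus, Circle.coe_exp, ← Complex.exp_add]
    congr 1
    have h5 : 4 * ((ν 2 : ℂ) + k) * s = 1 := by
      have : 4 * ((ν 2 : ℝ) + k) * s = 1 := by
        simp only [s]
        field_simp
      exact_mod_cast this
    simp only [masterCoords, center]
    simp
    linear_combination Real.pi * Complex.I * h5
  rw [h1, h3, h4, Complex.exp_pi_mul_I] at h2
  have h6 : (Circle.exp (-(4 * Real.pi * k * s)) : ℂ) ≠ 0 := Circle.coe_ne_zero _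
  have h7 : (2 : ℂ) * (Circle.exp (-(4 * Real.pi * k * s)) * coef f ν p) = 0 := by
    linear_combination h2
  simpa [h6] using h7

/-- Parseval's identity on the torus. -/
theorem lintegral_eq_tsum_mFourierCoeff {f : Torus → ℂ} (hf : MemLp f 2) :
    ∫⁻ τ, ‖f τ‖ₑ ^ 2 = ∑' ν, ‖mFourierCoeff f ν‖ₑ ^ 2 := by
  have h1 := hasSum_sq_mFourierCoeff (hf.toLp f)
  have h2 (ν : Fin 3 → ℤ) : mFourierCoeff (hf.toLp f) ν = mFourierCoeff f ν := by
    refine integral_congr_ae ?_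
    filter_upwards [hf.coeFn_toLp] with τ hτ
    rw [hτ]
  have h3 : ∫ τ, ‖hf.toLp f τ‖ ^ 2 = ∫ τ, ‖f τ‖ ^ 2 := by
    refine integral_congr_ae ?_
    filter_upwards [hf.coeFn_toLp] with τ hτ
    rw [hτ]
  simp only [h2, h3] at h1
  have h4 (z : ℂ) : ‖z‖ₑ ^ 2 = ENNReal.ofReal (‖z‖ ^ 2) := by
    rw [ENNReal.ofReal_pow (norm_nonneg z), ofReal_norm]
  simp only [h4]
  rw [← ofReal_integral_eq_lintegral_ofReal ((memLp_two_iff_integrable_sq_norm hf.1).1 hf)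
    (by filter_upwards with τ using by positivity), ← h1.tsum_eq,
    ENNReal.ofReal_tsum_of_nonneg (fun ν => by positivity) h1.summable]

/-! ### Frequencies of central character `-k` modulo integral translations -/

theorem exists_eq_add_two_mul {k : ℤ} (hk : k ≠ 0) (m : ℤ) :
    ∃ (j : Fin (2 * k.natAbs)) (a : ℤ), m = j + 2 * k * a := by
  have h1 := Int.emod_nonneg m (by omega : 2 * k ≠ 0)
  have h2 := Int.emod_lt m (by omega : 2 * k ≠ 0)
  refine ⟨⟨(m % (2 * k)).toNat, by omega⟩, m / (2 * k), ?_⟩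
  have h3 := Int.emod_add_mul_ediv m (2 * k)
  simp only [Int.toNat_of_nonneg h1]
  linarith

theorem eq_of_add_two_mul_eq {k : ℤ} (hk : k ≠ 0) {j j' : Fin (2 * k.natAbs)} {a a' : ℤ}
    (h : (j : ℤ) + 2 * k * a = j' + 2 * k * a') : j = j' ∧ a = a' := by
  have h1 : ((j : ℤ) - j') = 0 := by
    have h2 : 2 * k ∣ (j : ℤ) - j' := ⟨a' - a, by linarith⟩
    refine Int.eq_zero_of_dvd_of_natAbs_lt_natAbs h2 ?_
    have := j.2
    have := j'.2
    omega
  have h2 : 2 * k * (a - a') = 0 := by linarith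
  have h3 : a - a' = 0 := by
    rcases mul_eq_zero.1 h2 with h | h
    · exact absurd (by omega) hk
    · exact h
  exact ⟨Fin.ext (by omega), by omega⟩

/-- Representatives of the frequencies of central character `-k`. -/
def freq (k : ℤ) (j : Fin (2 * k.natAbs) × Fin (2 * k.natAbs)) : Fin 3 → ℤ := ![j.1, j.2, -k]

/-- Component 1 is `j + 2ka`, which determines `j` and `a`; component 0 then determines `i` and `b`
modulo `2k` in the same way. So the action is free and the representatives are inequivalent. -/
theorem shiftFreq_injective {k : ℤ} (hk : k ≠ 0) : Function.Injective
    fun q : (Fin (2 * k.natAbs) × Fin (2 * k.natAbs)) × (ℤ × ℤ) =>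
      shiftFreq q.2 (freq k q.1) := by
  rintro ⟨⟨i, j⟩, a, b⟩ ⟨⟨i', j'⟩, a', b'⟩ h
  have h0 : (i : ℤ) + j * a + -k * (2 * b - a ^ 2) = i' + j' * a' + -k * (2 * b' - a' ^ 2) :=
    congrFun h 0
  have h1 : (j : ℤ) - 2 * a * -k = j' - 2 * a' * -k := congrFun h 1
  obtain ⟨rfl, rfl⟩ := eq_of_add_two_mul_eq hk (by linarith : (j : ℤ) + 2 * k * a = j' + 2 * k * a')
  obtain ⟨rfl, h2⟩ := eq_of_add_two_mul_eq hk
    (by linarith : (i : ℤ) + 2 * k * (-b) = i' + 2 * k * (-b'))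
  obtain rfl : b = b' := by omega
  rfl

theorem exists_shiftFreq_eq {k : ℤ} (hk : k ≠ 0) {ν : Fin 3 → ℤ} (hν : ν 2 = -k) :
    ∃ q : (Fin (2 * k.natAbs) × Fin (2 * k.natAbs)) × (ℤ × ℤ), shiftFreq q.2 (freq k q.1) = ν := by
  obtain ⟨j, a, hj⟩ := exists_eq_add_two_mul hk (ν 1)
  -- The contributions `j a + k a²` of the first translation are removed; what remains is `i + 2kb`,
  -- whence the witness `-b`.
  obtain ⟨i, b, hi⟩ := exists_eq_add_two_mul hk (ν 0 - j * a - k * a ^ 2)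
  refine ⟨((i, j), (a, -b)), ?_⟩
  ext l
  fin_cases l
  · change (i : ℤ) + j * a + -k * (2 * -b - a ^ 2) = ν 0
    linarith
  · change (j : ℤ) - 2 * a * -k = ν 1
    linarith
  · exact hν.symm

/-! ### Parseval's identity -/

theorem enorm_sq_eq_lintegral {X : Type*} [MeasurableSpace X] {μ : Measure X} (f : Lp ℂ 2 μ) :
    ‖f‖ₑ ^ 2 = ∫⁻ x, ‖f x‖ₑ ^ 2 ∂μ := by
  rw [Lp.enorm_def, eLpNorm_eq_lintegral_rpow_enorm_toReal two_ne_zero ENNReal.ofNat_ne_top]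
  rw [← ENNReal.rpow_natCast, ← ENNReal.rpow_mul]
  simp

/-- Unfolding: fibrewise Parseval gives a sum over all frequencies on one cell. Those with `ν 2 =
-k` are each a unique translate of a representative, so summing over translations extends the
integral to the plane. The factor 2 comes from `lintegral_theta`. -/
theorem tsum_lintegral_coef {k : ℤ} (hk : k ≠ 0) {f : Lp ℂ 2 volP} (hf : f ∈ L2k k) :
    ∑ j, ∫⁻ p, ‖coef f (freq k j) p‖ₑ ^ 2 = 2 * ‖f‖ₑ ^ 2 := by
  have hfm := (Lp.stronglyMeasurable f).measurable
  have hc (ν : Fin 3 → ℤ) : Measurable fun p => ‖coef f ν p‖ₑ ^ 2 :=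
    (measurable_coef hfm ν).enorm.pow_const 2
  rw [enorm_sq_eq_lintegral, ← lintegral_theta (hfm.enorm.pow_const 2)]
  have h1 : ∫⁻ p in cellAt 0, ∫⁻ τ, ‖f (theta p τ)‖ₑ ^ 2 =
      ∑' ν, ∫⁻ p in cellAt 0, ‖coef f ν p‖ₑ ^ 2 := by
    rw [← lintegral_tsum fun ν => (hc ν).aemeasurable]
    refine lintegral_congr_ae (ae_restrict_of_ae ?_)
    filter_upwards [ae_memLp_theta f] with p hp
    exact lintegral_eq_tsum_mFourierCoeff hp
  rw [h1, ← (shiftFreq_injective hk).tsum_eq, ENNReal.tsum_prod', tsum_fintype]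
  · refine Finset.sum_congr rfl fun j _ => ?_
    rw [lintegral_eq_tsum_cellAt (hc _)]
    simp only [coef_shift hfm]
  · intro ν hν
    by_contra h
    refine hν ?_
    have h2 : ν 2 ≠ -k := fun h2 => h (exists_shiftFreq_eq hk h2)
    change ∫⁻ p in cellAt 0, ‖coef f ν p‖ₑ ^ 2 = 0
    rw [lintegral_eq_zero_iff (hc ν)]
    refine ae_restrict_of_ae ?_
    filter_upwards [coef_eq_zero hf h2] with p hp
    simp [hp]

theorem memLp_coef {k : ℤ} (hk : k ≠ 0) {f : Lp ℂ 2 volP} (hf : f ∈ L2k k)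
    (j : Fin (2 * k.natAbs) × Fin (2 * k.natAbs)) : MemLp (coef f (freq k j)) 2 := by
  refine ⟨(measurable_coef (Lp.stronglyMeasurable f).measurable _).aestronglyMeasurable, ?_⟩
  rw [eLpNorm_lt_top_iff_lintegral_rpow_enorm_lt_top two_ne_zero ENNReal.ofNat_ne_top]
  have h1 : ∫⁻ p, ‖coef f (freq k j) p‖ₑ ^ 2 ≤ 2 * ‖f‖ₑ ^ 2 := by
    rw [← tsum_lintegral_coef hk hf]
    exact Finset.single_le_sum (f := fun j => ∫⁻ p, ‖coef f (freq k j) p‖ₑ ^ 2)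
      (fun _ _ => bot_le) (Finset.mem_univ j)
  have h2 : 2 * ‖f‖ₑ ^ 2 < ⊤ := by finiteness
  simpa using h1.trans_lt h2

/-- The component of frequency `j` of a function of central character `k`, as an operator to
`L²(ℝ²)`. -/
def coefLp {k : ℤ} (hk : k ≠ 0) (j : Fin (2 * k.natAbs) × Fin (2 * k.natAbs)) :
    L2k k →ₗ[ℂ] Lp ℂ 2 (volume : Measure (ℝ × ℝ)) where
  toFun f := (memLp_coef hk f.2 j).toLp
  map_add' f f' := by
    apply Lp.ext
    filter_upwards [MemLp.coeFn_toLp (memLp_coef hk (f + f').2 j),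
      MemLp.coeFn_toLp (memLp_coef hk f.2 j), MemLp.coeFn_toLp (memLp_coef hk f'.2 j),
      Lp.coeFn_add (memLp_coef hk f.2 j).toLp (memLp_coef hk f'.2 j).toLp,
      coef_add (f : Lp ℂ 2 volP) f' (freq k j)] with p h1 h2 h3 h4 h5
    rw [h1, h4, Pi.add_apply, h2, h3, ← h5]
    rfl
  map_smul' c f := by
    apply Lp.ext
    filter_upwards [MemLp.coeFn_toLp (memLp_coef hk (c • f).2 j),
      MemLp.coeFn_toLp (memLp_coef hk f.2 j),
      Lp.coeFn_smul c (memLp_coef hk f.2 j).toLp,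
      coef_smul c (f : Lp ℂ 2 volP) (freq k j)] with p h1 h2 h3 h4
    rw [h1, RingHom.id_apply, h3, Pi.smul_apply, h2, smul_eq_mul, ← h4]
    rfl

theorem coeFn_coefLp {k : ℤ} (hk : k ≠ 0) (j : Fin (2 * k.natAbs) × Fin (2 * k.natAbs))
    (f : L2k k) : ⇑(coefLp hk j f) =ᵐ[volume] coef (f : Lp ℂ 2 volP) (freq k j) :=
  MemLp.coeFn_toLp (memLp_coef hk f.2 j)

theorem sum_norm_sq_coefLp {k : ℤ} (hk : k ≠ 0) (f : L2k k) :
    ∑ j, ‖coefLp hk j f‖ ^ 2 = 2 * ‖f‖ ^ 2 := by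
  have h1 := tsum_lintegral_coef hk f.2
  have h2 (j : Fin (2 * k.natAbs) × Fin (2 * k.natAbs)) :
      ∫⁻ p, ‖coef (f : Lp ℂ 2 volP) (freq k j) p‖ₑ ^ 2 = ‖coefLp hk j f‖ₑ ^ 2 := by
    rw [enorm_sq_eq_lintegral]
    refine lintegral_congr_ae ?_
    filter_upwards [coeFn_coefLp hk j f] with p hp
    rw [hp]
  simp only [h2] at h1
  have h3 := congrArg ENNReal.toReal h1
  rw [ENNReal.toReal_sum (fun j _ => by finiteness)] at h3
  simpa using h3

/-! ### The Fourier coefficients as intertwining operators. -/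

/-- The functional whose character of `H⁰` has the frequency `freq k j`. -/
def freqFunctional (k : ℤ) (j : Fin (2 * k.natAbs) × Fin (2 * k.natAbs)) :
    Module.Dual ℝ LieGt where
  -- The last torus coordinate is twice the `U`-coordinate, so the frequency `-k` becomes `-2k` on
  -- `U`.
  toFun X := (j.1 : ℕ) * X.2.1 + (j.2 : ℕ) * X.2.2.1 + -2 * k * X.2.2.2.2
  map_add' X Y := by simp; ring
  map_smul' c X := by simp; ring

theorem character_freqFunctional (k : ℤ) (j : Fin (2 * k.natAbs) × Fin (2 * k.natAbs)) (g : Gt)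
    (p : ℝ × ℝ) : (character (freqFunctional k j) (master g p) : ℂ) =
      mFourier (freq k j) (toTorus (masterCoords g p)) := by
  rw [coe_character_master, mFourier_toTorus]
  congr 1
  simp [freqFunctional, freq, masterCoords]
  ring

theorem coefLp_rhoK {k : ℤ} (hk : k ≠ 0) (j : Fin (2 * k.natAbs) × Fin (2 * k.natAbs)) (g : Gt)
    (f : L2k k) : coefLp hk j (rhoK k g f) = inducedRep (freqFunctional k j) g (coefLp hk j f) := by
  apply Lp.ext
  filter_upwards [coeFn_coefLp hk j (rhoK k g f),
    coeFn_inducedRep (freqFunctional k j) g (coefLp hk j f),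
    (measurePreserving_actH g).quasiMeasurePreserving.ae (coeFn_coefLp hk j f),
    coef_rho g (f : Lp ℂ 2 volP) (freq k j)] with p h1 h2 h3 h4
  rw [h1, h2, h3, character_freqFunctional, ← h4]
  rfl

theorem completeSpace_L2k (k : ℤ) : CompleteSpace (L2k k) := by
  have h : (L2k k : Set (Lp ℂ 2 volP)) =
      ⋂ s : ℝ, {f | rho (center s) f = (Circle.exp (-(4 * Real.pi * k * s)) : ℂ) • f} := by
    ext f
    simp only [Set.mem_iInter]
    rfl
  have hc : IsClosed (L2k k : Set (Lp ℂ 2 volP)) := by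
    rw [h]
    exact isClosed_iInter fun s =>
      isClosed_eq (rho (center s)).continuous (continuous_const_smul _)
  exact hc.completeSpace_coe

/-! ### Functions with a single frequency -/

/-- The coordinates of a group element along the fibre, after a reduction of its image in the
plane to the unit cell. -/
def fibreCoords (g : Gt) : Fin 3 → ℝ :=
  -- Left multiplication by `(-⌊a1⌋, 0, 0, -⌊r⌋, 0)` subtracts `⌊r⌋ a2` from `v`; the entries then
  -- invert `param`.
  ![g.a2, g.a3 + g.a2 * Int.fract g.a1,
    2 * (g.v - ⌊g.r⌋ * g.a2 - g.a3 * Int.fract g.a1 - g.a2 * Int.fract g.a1 ^ 2 / 2)]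

/-- Left translation by `Gam` changes the coordinates by integers, which makes `fibreCoord` well
defined on `P`. -/
theorem toTorus_fibreCoords_mul (c : Gam) (g : Gt) :
    toTorus (fibreCoords ((c : Gt) * g)) = toTorus (fibreCoords g) := by
  obtain ⟨c, ⟨x, hx⟩, ⟨y, hy⟩, ⟨z, hz⟩, ⟨t, ht⟩, ⟨v, hv⟩⟩ := c
  have key (r s : ℝ) (n : ℤ) (h : r = s + n) : (r : UnitAddCircle) = s := by
    rw [h, AddCircle.coe_add, add_eq_left, AddCircle.coe_eq_zero_iff]
    exact ⟨n, by simp⟩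
  have hX : Int.fract g.a1 = g.a1 - ⌊g.a1⌋ := rfl
  ext i
  fin_cases i
  · refine key _ _ y ?_
    change c.a2 + g.a2 = g.a2 + y
    rw [hy, add_comm]
  · refine key _ _ (z - y * ⌊g.a1⌋) ?_
    change c.a3 + g.a3 - c.a2 * g.a1 + (c.a2 + g.a2) * Int.fract (c.a1 + g.a1) =
      g.a3 + g.a2 * Int.fract g.a1 + _
    rw [hx, hy, hz, Int.fract_intCast_add, hX]
    push_cast
    ring
  · refine key _ _ (v + 2 * z * ⌊g.a1⌋ - 2 * ⌊g.r⌋ * y - 2 * t * y - y * ⌊g.a1⌋ ^ 2) ?_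
    change 2 * (c.v + g.v + c.a3 * g.a1 - c.a2 * g.a1 ^ 2 / 2 + c.r * g.a2 -
      ⌊c.r + g.r⌋ * (c.a2 + g.a2) - (c.a3 + g.a3 - c.a2 * g.a1) * Int.fract (c.a1 + g.a1) -
        (c.a2 + g.a2) * Int.fract (c.a1 + g.a1) ^ 2 / 2) =
      2 * (g.v - ⌊g.r⌋ * g.a2 - g.a3 * Int.fract g.a1 - g.a2 * Int.fract g.a1 ^ 2 / 2) + _
    rw [hx, hy, hz, ht, hv, Int.fract_intCast_add, Int.floor_intCast_add, hX]
    push_cast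
    ring

/-- The coordinate of a point of `P` along its fibre over the unit cell. -/
def fibreCoord : P → Torus :=
  Quotient.lift (fun g => toTorus (fibreCoords g)) (by
    intro g g' hg
    obtain ⟨c, rfl⟩ := toP_eq_iff.1 (Quotient.sound hg : toP g = toP g')
    exact (toTorus_fibreCoords_mul c g).symm)

theorem measurable_fibreCoord : Measurable fibreCoord := by
  apply measurable_from_quotient.2
  have h1 := Gt.measurable_a1
  have h2 := Gt.measurable_a2
  have h3 := Gt.measurable_a3
  have h4 := Gt.measurable_r
  have h5 := Gt.measurable_v
  refine measurable_pi_lambda _ fun i => AddCircle.measurable_mk'.comp ?_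
  fin_cases i
  · exact h2
  · change Measurable fun g : Gt => g.a3 + g.a2 * Int.fract g.a1
    fun_prop
  · change Measurable fun g : Gt => 2 * (g.v - ⌊g.r⌋ * g.a2 - g.a3 * Int.fract g.a1 -
      g.a2 * Int.fract g.a1 ^ 2 / 2)
    have h6 : Measurable fun g : Gt => (⌊g.r⌋ : ℝ) :=
      (measurable_of_countable (fun n : ℤ => (n : ℝ))).comp (Int.measurable_floor.comp h4)
    fun_prop

theorem fibreCoord_theta {p : ℝ × ℝ} (hp : p ∈ cellAt 0) (τ : Torus) :
    fibreCoord (theta p τ) = τ := by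
  obtain ⟨x, rfl⟩ : ∃ x, τ = toTorus x := ⟨_, (toTorus_torusRep τ).symm⟩
  rw [theta_toTorus]
  change toTorus (fibreCoords (elH x * sec p)) = _
  congr 1
  have h1 : ⌊p.1⌋ = 0 := hp.1
  have h2 : ⌊p.2⌋ = 0 := hp.2
  have h3 : Int.fract p.1 = p.1 := by rw [Int.fract, h1, Int.cast_zero, sub_zero]
  ext i
  fin_cases i
  · exact add_zero _
  · change x 1 + 0 - x 0 * p.1 + (x 0 + 0) * Int.fract (0 + p.1) = x 1
    rw [zero_add, h3]
    ring
  · change 2 * (x 2 / 2 + 0 + x 1 * p.1 - x 0 * p.1 ^ 2 / 2 + 0 * 0 - ⌊0 + p.2⌋ * (x 0 + 0) -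
      (x 1 + 0 - x 0 * p.1) * Int.fract (0 + p.1) - (x 0 + 0) * Int.fract (0 + p.1) ^ 2 / 2) = x 2
    rw [zero_add, zero_add, h3, h2]
    push_cast
    ring

theorem fibreCoord_actP_center (s : ℝ) (x : P) :
    fibreCoord (actP (center s) x) = toTorus ![0, 0, 2 * s] + fibreCoord x := by
  induction x using Quotient.inductionOn with
  | h g =>
    change toTorus (fibreCoords (g * center s)) = toTorus _ + toTorus (fibreCoords g)
    rw [← toTorus_add]
    congr 1
    have h1 : g * center s = ⟨g.a1, g.a2, g.a3, g.r, g.v + s⟩ := by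
      ext <;> simp [Gt.mul_def, center]
    rw [h1]
    ext i
    fin_cases i
    · simp [fibreCoords]
    · simp [fibreCoords]
    · simp [fibreCoords]
      ring

theorem volP_univ : 2 * volP Set.univ = 1 := by
  have h1 := lintegral_theta (F := fun _ => 1) measurable_const
  have h2 : cellAt 0 = Set.Ico (0 : ℝ) 1 ×ˢ Set.Ico (0 : ℝ) 1 := by
    ext p
    simp [cellAt]
  simp only [lintegral_const, measure_univ, one_mul] at h1
  rw [← h1, Measure.restrict_apply_univ, h2, Measure.volume_eq_prod, Measure.prod_prod,
    Real.volume_Ico]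
  simp

/-- The function may jump at the boundary of the cell, but it is bounded and measurable and `volP`
has total mass 1/2. -/
theorem memLp_mFourier_fibreCoord (ν : Fin 3 → ℤ) :
    MemLp (fun x => mFourier ν (fibreCoord x)) 2 volP := by
  have : IsFiniteMeasure volP := by
    refine ⟨lt_top_iff_ne_top.2 fun h => ?_⟩
    have h1 := volP_univ
    rw [h] at h1
    simp at h1
  refine MemLp.of_bound
    ((mFourier ν).continuous.measurable.comp measurable_fibreCoord).aestronglyMeasurable
    ‖mFourier ν‖ ?_
  filter_upwards with x
  exact (mFourier ν).norm_coe_le_norm _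

theorem toLp_mFourier_mem_L2k {k : ℤ} {ν : Fin 3 → ℤ} (hν : ν 2 = -k) :
    (memLp_mFourier_fibreCoord ν).toLp ∈ L2k k := by
  intro s
  apply Lp.ext
  have h1 := (memLp_mFourier_fibreCoord ν).coeFn_toLp
  filter_upwards [coeFn_rho (center s) (memLp_mFourier_fibreCoord ν).toLp, h1,
    (measurePreserving_actP (center s)).quasiMeasurePreserving.ae h1,
    Lp.coeFn_smul (Circle.exp (-(4 * Real.pi * k * s)) : ℂ) (memLp_mFourier_fibreCoord ν).toLp]
    with x h2 h3 h4 h5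
  rw [h2, h4, h5, Pi.smul_apply, h3, fibreCoord_actP_center, mFourier_apply_add, smul_eq_mul,
    mFourier_toTorus, Circle.coe_exp]
  congr 2
  simp [hν]
  ring

theorem mFourierCoeff_mFourier {ν ν' : Fin 3 → ℤ} (h : ν ≠ ν') :
    mFourierCoeff (mFourier ν) ν' = 0 := by
  rw [← mFourierCoeff_toLp, ← mFourierBasis_repr]
  have h1 : ContinuousMap.toLp (E := ℂ) 2 volume ℂ (mFourier ν) = mFourierBasis ν := by
    rw [coe_mFourierBasis]
  rw [h1, HilbertBasis.repr_self]
  simp [h.symm]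

/-- In each frequency class there is a nonzero function of central character `k`. -/
theorem exists_single_freq {k : ℤ} (hk : k ≠ 0) (j : Fin (2 * k.natAbs) × Fin (2 * k.natAbs)) :
    ∃ f : L2k k, f ≠ 0 ∧ ∀ j' ≠ j, coefLp hk j' f = 0 := by
  let f : L2k k := ⟨(memLp_mFourier_fibreCoord (freq k j)).toLp, toLp_mFourier_mem_L2k rfl⟩
  have hf : ⇑(f : Lp ℂ 2 volP) =ᵐ[volP] fun x => mFourier (freq k j) (fibreCoord x) :=
    (memLp_mFourier_fibreCoord (freq k j)).coeFn_toLp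
  refine ⟨f, fun h0 => ?_, fun j' hj' => ?_⟩
  · have h1 : ∀ᵐ x ∂volP, False := by
      have h2 : (f : Lp ℂ 2 volP) = 0 := congrArg Subtype.val h0
      rw [h2] at hf
      filter_upwards [hf, Lp.coeFn_zero ℂ 2 volP] with x h3 h4
      rw [h4] at h3
      have h5 := mFourier_neg_mul_self (freq k j) (fibreCoord x)
      rw [← h3] at h5
      simp at h5
    have h3 := volP_univ
    have h4 : volP Set.univ = 0 := by simpa [ae_iff] using h1
    rw [h4] at h3
    simp at h3
  · apply Lp.ext
    have hm : Measurable fun x => mFourier (freq k j) (fibreCoord x) :=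
      (mFourier (freq k j)).continuous.measurable.comp measurable_fibreCoord
    have h1 : coef (fun x => mFourier (freq k j) (fibreCoord x)) (freq k j') =ᵐ[volume] 0 := by
      -- On the cell `a` the coefficient equals the one of frequency `shiftFreq a (freq k j')` on
      -- the unit cell, where the function is a single character. It could survive only if `j` and
      -- `j'` had the same orbit.
      refine ae_of_ae_cellAt fun a => ?_
      filter_upwards [ae_restrict_mem (measurableSet_cellAt 0)] with p hp
      rw [coef_shift hm]
      simp only [coef, fibreCoord_theta hp]
      refine mFourierCoeff_mFourier fun h => hj' ?_
      have h2 : shiftFreq 0 (freq k j) = shiftFreq a (freq k j') := by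
        rw [← h]
        ext i
        fin_cases i <;> simp [shiftFreq]
      exact (congrArg Prod.fst (shiftFreq_injective hk (a₁ := (j, 0)) (a₂ := (j', a)) h2)).symm
    filter_upwards [coeFn_coefLp hk j' f, coef_congr hf (freq k j'), h1,
      Lp.coeFn_zero ℂ 2 (volume : Measure (ℝ × ℝ))] with p h2 h3 h4 h5
    rw [h2, h3, h4, h5]

/-! ### Assembly of the decomposition, and the orbit condition. -/

/-- `L²_k(P)` is a direct sum of `4k²` copies of the representation of the orbit. -/
theorem unitarilyEquivalent_copies_rhoK {k : ℤ} (hk : k ≠ 0) (l : Module.Dual ℝ LieGt)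
    (hl : l (0, 0, 0, 0, 1) = -2 * k) :
    UnitarilyEquivalent (copies (4 * k.natAbs ^ 2) (inducedRep l)) (rhoK k) := by
  have hk' : (-2 * k : ℝ) ≠ 0 := mul_ne_zero (by norm_num) (Int.cast_ne_zero.2 hk)
  have hL := hasScalarCommutant_inducedRep l (hl ▸ hk')
  have := completeSpace_L2k k
  have hU (j : Fin (2 * k.natAbs) × Fin (2 * k.natAbs)) :
      UnitarilyEquivalent (inducedRep (freqFunctional k j)) (inducedRep l) := by
    have h1 : freqFunctional k j (0, 0, 0, 0, 1) = -2 * k := by simp [freqFunctional]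
    exact unitarilyEquivalent_inducedRep _ _ (h1 ▸ hk') (h1.trans hl.symm)
  choose U hU using hU
  have hcard : Fintype.card (Fin (2 * k.natAbs) × Fin (2 * k.natAbs)) = 4 * k.natAbs ^ 2 := by
    rw [Fintype.card_prod, Fintype.card_fin]
    ring
  have e := (Fintype.equivFinOfCardEq hcard).symm
  -- This normalisation cancels the factor 2 in `sum_norm_sq_coefLp`.
  let c : ℂ := ((Real.sqrt 2)⁻¹ : ℝ)
  have hc : ‖c‖ ^ 2 = 2⁻¹ := by
    rw [Complex.norm_real, norm_inv, inv_pow, Real.norm_of_nonneg (Real.sqrt_nonneg _),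
      Real.sq_sqrt zero_le_two]
  let B0 : L2k k →ₗ[ℂ] PiLp 2 (fun _ : Fin (4 * k.natAbs ^ 2) =>
      Lp ℂ 2 (volume : Measure (ℝ × ℝ))) :=
    (PiLp.continuousLinearEquiv 2 ℂ (fun _ : Fin (4 * k.natAbs ^ 2) =>
      Lp ℂ 2 (volume : Measure (ℝ × ℝ)))).symm.toLinearEquiv.toLinearMap ∘ₗ
      LinearMap.pi fun i => c • ((U (e i)).toLinearEquiv.toLinearMap ∘ₗ coefLp hk (e i))
  have hB0 (f : L2k k) (i : Fin (4 * k.natAbs ^ 2)) :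
      B0 f i = c • U (e i) (coefLp hk (e i) f) := rfl
  let B : L2k k →ₗᵢ[ℂ] PiLp 2 (fun _ : Fin (4 * k.natAbs ^ 2) =>
      Lp ℂ 2 (volume : Measure (ℝ × ℝ))) :=
    { toLinearMap := B0
      norm_map' := fun f => by
        refine (sq_eq_sq₀ (norm_nonneg _) (norm_nonneg _)).1 ?_
        rw [PiLp.norm_sq_eq_of_L2]
        simp only [hB0, norm_smul, LinearIsometryEquiv.norm_map, mul_pow, hc]
        rw [← Finset.mul_sum, e.sum_comp fun j => ‖coefLp hk j f‖ ^ 2, sum_norm_sq_coefLp]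
        ring }
  have hB (f : L2k k) (i : Fin (4 * k.natAbs ^ 2)) :
      B f i = c • U (e i) (coefLp hk (e i) f) := rfl
  refine hL.unitarilyEquivalent_copies B ?_ ?_
  · intro g f i
    rw [hB, hB, coefLp_rhoK, hU, map_smul]
  · intro d hd
    ext i
    -- On this `f` a linear relation reduces to its `i`-th term, and that component is nonzero
    -- because `B` is injective.
    obtain ⟨f, hf0, hf⟩ := exists_single_freq hk (e i)
    have h1 (i' : Fin (4 * k.natAbs ^ 2)) (hi : i' ≠ i) : B f i' = 0 := by
      rw [hB, hf _ (e.injective.ne hi), map_zero, smul_zero]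
    have h2 : d i • B f i = 0 := by
      refine (Finset.sum_eq_single (f := fun i' => d i' • B f i') i (fun i' _ hi => ?_)
        (fun h => absurd (Finset.mem_univ i) h)).symm.trans (hd f)
      rw [h1 i' hi, smul_zero]
    rcases smul_eq_zero.1 h2 with h3 | h3
    · exact h3
    · refine absurd (B.injective ?_) hf0
      rw [map_zero]
      ext1 i'
      by_cases hi : i' = i
      · rw [hi, h3]
        rfl
      · rw [h1 i' hi]
        rfl

/-- The functionals in the orbit of `μ U*` agree on the centre. -/
theorem apply_center_of_mem_coadjointOrbit {μ : ℝ} {l : Module.Dual ℝ LieGt}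
    (hl : l ∈ coadjointOrbit (uFunctional μ)) : l (0, 0, 0, 0, 1) = μ := by
  obtain ⟨g, hg⟩ := hl
  have h1 : DifferentiableAt ℝ
      (fun X : LieGt => Gt.coords (g⁻¹ * Gt.coords.symm X * g⁻¹⁻¹)) 0 := by
    simp only [Gt.mul_def, Gt.coords, Equiv.coe_fn_mk, Equiv.coe_fn_symm_mk]
    fun_prop
  have h2 : HasDerivAt (fun s : ℝ => s • ((0, 0, 0, 0, 1) : LieGt)) (0, 0, 0, 0, 1) 0 := by
    simpa using (hasDerivAt_id (0 : ℝ)).smul_const ((0, 0, 0, 0, 1) : LieGt)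
  -- Conjugation fixes the central curve `exp(sU)`, so the curve also has derivative `Ad g⁻¹ U`;
  -- uniqueness of derivatives gives `Ad g⁻¹ U = U`.
  have h3 : HasDerivAt (fun s : ℝ => s • ((0, 0, 0, 0, 1) : LieGt))
      (Ad g⁻¹ (0, 0, 0, 0, 1)) 0 := by
    have h4 : HasFDerivAt (fun X : LieGt => Gt.coords (g⁻¹ * Gt.coords.symm X * g⁻¹⁻¹))
        (Ad g⁻¹) ((0 : ℝ) • ((0, 0, 0, 0, 1) : LieGt)) := by
      rw [zero_smul]
      exact h1.hasFDerivAt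
    refine (h4.comp_hasDerivAt (0 : ℝ) h2).congr_of_eventuallyEq ?_
    filter_upwards with s
    have h5 : Gt.coords.symm (s • ((0, 0, 0, 0, 1) : LieGt)) = center s := by
      simp [Gt.coords, center]
    simp only [Function.comp_apply, h5]
    rw [← center_mul_comm, mul_inv_cancel_right]
    simp [Gt.coords, center]
  rw [hg, h3.unique h2]
  exact mul_one μ

end KodairaThurston

end

theorem mainTheorem2 (k : ℤ) (hk : k ≠ 0) (l : Module.Dual ℝ KodairaThurston.LieGt)
    (hl : l ∈ KodairaThurston.coadjointOrbit (KodairaThurston.uFunctional (-2 * k))) :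
    KodairaThurston.IsIrreducible (KodairaThurston.inducedRep l) ∧
    KodairaThurston.multiplicity (KodairaThurston.inducedRep l) (KodairaThurston.rhoK k) =
      ((4 * k.natAbs ^ 2 : ℕ) : Cardinal) ∧
    KodairaThurston.UnitarilyEquivalent
      (KodairaThurston.copies (4 * k.natAbs ^ 2) (KodairaThurston.inducedRep l))
      (KodairaThurston.rhoK k) := by
  have h1 := KodairaThurston.apply_center_of_mem_coadjointOrbit hl
  have h2 : l (0, 0, 0, 0, 1) ≠ 0 := by
    rw [h1]
    exact mul_ne_zero (by norm_num) (Int.cast_ne_zero.2 hk)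
  have h3 := KodairaThurston.hasScalarCommutant_inducedRep l h2
  have h4 := KodairaThurston.unitarilyEquivalent_copies_rhoK hk l h1
  have := KodairaThurston.nontrivial_L2
  exact ⟨h3.isIrreducible, h3.multiplicity_eq h4, h4⟩
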